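/- For $m, r \in \mathbb{N}$ let $\mathrm{RM}(m,r) \subseteq \mathbb{F}_2^{2^m}$ be the Reed-Muller code, that is, the linear code of all evaluation vectors $(f(a))_{a \in \mathbb{F}_2^m}$ of polynomials $f$ over $\mathbb{F}_2$ in $m$ variables of degree at most $r$. The rate of a linear code is its dimension divided by its block length. The binary erasure channel $\mathrm{BEC}(p)$, $p \in [0,1]$, replaces every bit of the transmitted word $y$ by '?' independently with probability $p$ and leaves it unchanged otherwise; $y$ is uniquely recovered from the output $z$ if $y$ is the only codeword that agrees with $z$ on the coordinates that are not erased. Theorem 1.7. Let $0 < \gamma \le 1/50$, where $\gamma$ is a constant or, more generally, a function $\gamma = \gamma(m)$ of $m$ with $0 < \gamma(m) \le 1/50$ for all $m$. Then the family $\mathrm{RM}(m, \lceil \gamma m \rceil)$ achieves capacity on the binary erasure channel. That is, for every $\delta > 0$, if $R_m$ is the rate of $\mathrm{RM}(m, \lceil \gamma m \rceil)$ and $p_m = 1 - (1+\delta) R_m$ (which lies in $[0,1]$ for all large $m$), then, as $m \to \infty$, $$\min_{y \in \mathrm{RM}(m, \lceil \gamma m \rceil)} \ \Pr_{z \sim \mathrm{BEC}(p_m)(y)}\bigl[\,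 y \text{ is uniquely recovered from } z \,\bigr] = 1 - o(1).$$ -/

import Mathlib

open Filter Topology

/-- The linear map sending a polynomial `f` in `m` variables over `𝔽₂` to its vector of
evaluations `(f(a))` indexed by the points `a ∈ 𝔽₂ᵐ`. -/
noncomputable def evalVector (m : ℕ) :
    MvPolynomial (Fin m) (ZMod 2) →ₗ[ZMod 2] ((Fin m → ZMod 2) → ZMod 2) :=
  LinearMap.pi fun a => (MvPolynomial.aeval a).toLinearMap

/-- The Reed-Muller code `RM(m, r)`: all evaluation vectors of polynomials over `𝔽₂` in `m`
variables of total degree at most `r`. -/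
noncomputable def reedMuller (m r : ℕ) : Submodule (ZMod 2) ((Fin m → ZMod 2) → ZMod 2) :=
  (MvPolynomial.restrictTotalDegree (Fin m) (ZMod 2) r).map (evalVector m)

theorem mem_reedMuller {m r : ℕ} {c : (Fin m → ZMod 2) → ZMod 2} :
    c ∈ reedMuller m r ↔
      ∃ f : MvPolynomial (Fin m) (ZMod 2), f.totalDegree ≤ r ∧
        ∀ a, c a = MvPolynomial.eval a f := by
  simp only [reedMuller, Submodule.mem_map, MvPolynomial.mem_restrictTotalDegree]
  constructor
  · rintro ⟨f, hf, rfl⟩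
    exact ⟨f, hf, fun a => by simp [evalVector, MvPolynomial.aeval_eq_eval]⟩
  · rintro ⟨f, hf, h⟩
    exact ⟨f, hf, by ext a; simp [evalVector, MvPolynomial.aeval_eq_eval, h]⟩

section Channel

variable {ι : Type*} [Fintype ι]

/-- The rate of a binary linear code: its dimension divided by its block length. -/
noncomputable def codeRate (C : Submodule (ZMod 2) (ι → ZMod 2)) : ℝ :=
  (Module.finrank (ZMod 2) C : ℝ) / (Fintype.card ι : ℝ)

/-- The probability that the binary erasure channel with parameter `p` outputs
`z ∈ {0, 1, ?}^ι` (the symbol `?` is `none`) on input `y`: independently at each coordinate, the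
bit is erased with probability `p` and is unchanged with probability `1 - p`. -/
noncomputable def becMass (p : unitInterval) (y : ι → ZMod 2) (z : ι → Option (ZMod 2)) : ℝ :=
  ∏ i, if z i = none then (p : ℝ) else if z i = some (y i) then 1 - (p : ℝ) else 0

theorem becMass_nonneg (p : unitInterval) (y : ι → ZMod 2) (z : ι → Option (ZMod 2)) :
    0 ≤ becMass p y z := by
  refine Finset.prod_nonneg fun i _ => ?_
  have h0 := p.2.1
  have h1 := p.2.2
  split_ifs <;> linarith

theorem sum_becMass [DecidableEq ι] (p : unitInterval) (y : ι → ZMod 2) :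
    ∑ z : ι → Option (ZMod 2), becMass p y z = 1 := by
  have h := (Fintype.prod_sum fun (i : ι) (o : Option (ZMod 2)) =>
    if o = none then (p : ℝ) else if o = some (y i) then 1 - (p : ℝ) else 0).symm
  refine h.trans (Finset.prod_eq_one fun i _ => ?_)
  rw [Fintype.sum_option]
  simp

open Classical in
/-- The probability of the event `E` when `z` is the output of the binary erasure channel with
parameter `p` on input `y`. -/
noncomputable def becProb (p : unitInterval) (y : ι → ZMod 2)
    (E : Set (ι → Option (ZMod 2))) : ℝ :=
  ∑ z : ι → Option (ZMod 2), if z ∈ E then becMass p y z else 0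

/-- `z` agrees with the word `c` on the coordinates of `z` that are not erased. -/
def AgreesWith (z : ι → Option (ZMod 2)) (c : ι → ZMod 2) : Prop :=
  ∀ i, z i = none ∨ z i = some (c i)

/-- The event that `y` can be uniquely recovered from the channel output `z`: it is the one and
only codeword of `C` that agrees with `z` on the coordinates that are not erased. -/
def uniquelyRecovers (C : Submodule (ZMod 2) (ι → ZMod 2)) (y : ι → ZMod 2) :
    Set (ι → Option (ZMod 2)) :=
  {z | ∀ c : ι → ZMod 2, (c ∈ C ∧ AgreesWith z c) ↔ c = y}

end Channel

section Families

variable {ι : ℕ → Type*} [∀ m, Fintype (ι m)]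

/-- The family `C m` recovers from random erasures with parameter `p m`: the transmitted codeword
is uniquely recovered with probability `1 - o(1)` as `m → ∞`, the `o(1)` being uniform in the
transmitted codeword. -/
def RecoversFromErasures (C : ∀ m, Submodule (ZMod 2) (ι m → ZMod 2))
    (p : ℕ → unitInterval) : Prop :=
  ∀ ε : ℝ, 0 < ε → ∀ᶠ m in atTop, ∀ y ∈ C m,
    1 - ε ≤ becProb (p m) y (uniquelyRecovers (C m) y)

/-- The erasure parameter `1 - R (1 + δ)`. It is cut off to lie in `[0, 1]`, which changes nothing
when it is a probability (always the case for all large `m` if the rates tend to `0`). -/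
noncomputable def erasureParam (R δ : ℝ) : unitInterval :=
  Set.projIcc 0 1 zero_le_one (1 - R * (1 + δ))

/-- The family `C m` achieves capacity for random erasures: for every `δ > 0` it recovers from
random erasures with parameter `1 - R_m (1 + δ)`, where `R_m` is the rate of `C m`. -/
def AchievesCapacityBEC (C : ∀ m, Submodule (ZMod 2) (ι m → ZMod 2)) : Prop :=
  ∀ δ : ℝ, 0 < δ → RecoversFromErasures C fun m => erasureParam (codeRate (C m)) δ

end Families

/-! Write `K` for the dimension of the code and `N` for its length. Unique recovery fails exactly
when some nonzero codeword vanishes on all kept coordinates. The expected number of kept coordinates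
is `(1 + δ) K`, so by a Chernoff bound at least `s ≈ (1 + δ/2) K` are kept with probability `1 -
o(1)`. A fixed codeword of relative weight `w` vanishes on at least `s` kept coordinates with
probability at most `(1 - w) ^ s`. It remains to show that the sum of `(1 - w) ^ s` over nonzero
codewords tends to `0`, which is a question about the weight distribution.

The weight distribution comes from `card_lowWeight_le`. Choose `t` random directions. Averaging the
support of `f` over the cube they span at `x` gives nearly the weight of `f` for most `x`, since
each direction halves the variance. If the `j`-fold derivatives of `f - g` along these directions
vanish, then at a point where `f - g ≠ 0` the minimum distance on the cube forces an unusually large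
average of `f` or `g`. Two light words with the same derivatives therefore differ in few places: up
to a factor `2`, light words are counted by the information in the derivatives times the number of
much lighter words. Iterating down to the minimum distance gives `card_lightWords_le_rpow`; one step
with `j = 1`, where the information lost is that of the code in `m - t` variables, gives
`card_biasedWords_le_rpow` for weights near `1/2`.

Degrees up to about `m/49` enter through one ratio: lowering the degree by one divides the dimension
by at least `48`, so derivatives carry little information. Light shells and finitely many biased
shells are then negligible already for `s ≥ K`. The surplus `δ` is needed only for the Chernoff
bound and for the balanced words, bounded by the trivial count `2 ^ K`. -/

section Cube

/-! ### Relative Hamming weight. -/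

variable {V : Type*}

/-- The real indicator of the support of `f`. -/
noncomputable def suppInd (f : V → ZMod 2) (x : V) : ℝ := if f x = 0 then 0 else 1

/-- The relative Hamming weight. -/
noncomputable def relWeight [Fintype V] (f : V → ZMod 2) : ℝ :=
  (∑ x, suppInd f x) / Fintype.card V

theorem suppInd_nonneg (f : V → ZMod 2) (x : V) : 0 ≤ suppInd f x := by
  unfold suppInd; split_ifs <;> norm_num

theorem suppInd_le_one (f : V → ZMod 2) (x : V) : suppInd f x ≤ 1 := by
  unfold suppInd; split_ifs <;> norm_num

theorem suppInd_sq (f : V → ZMod 2) (x : V) : suppInd f x ^ 2 = suppInd f x := by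
  unfold suppInd; split_ifs <;> norm_num

theorem suppInd_sub_le (f g : V → ZMod 2) (x : V) :
    suppInd (f - g) x ≤ suppInd f x + suppInd g x := by
  by_cases h : f x = 0 ∧ g x = 0
  · simp [suppInd, h.1, h.2]
  · refine (suppInd_le_one _ _).trans ?_
    by_cases hf : f x = 0
    · have : suppInd g x = 1 := if_neg fun hg => h ⟨hf, hg⟩
      linarith [suppInd_nonneg f x]
    · have : suppInd f x = 1 := if_neg hf
      linarith [suppInd_nonneg g x]

theorem card_pos_real [Fintype V] [Nonempty V] : (0 : ℝ) < Fintype.card V := by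
  exact_mod_cast Fintype.card_pos

theorem relWeight_nonneg [Fintype V] [Nonempty V] (f : V → ZMod 2) : 0 ≤ relWeight f :=
  div_nonneg (Finset.sum_nonneg fun x _ => suppInd_nonneg f x) card_pos_real.le

theorem relWeight_le_one [Fintype V] [Nonempty V] (f : V → ZMod 2) : relWeight f ≤ 1 := by
  rw [relWeight, div_le_one card_pos_real]
  calc _ ≤ ∑ _x : V, (1 : ℝ) := Finset.sum_le_sum fun x _ => suppInd_le_one f x
    _ = _ := by simp

theorem sum_suppInd [Fintype V] [Nonempty V] (f : V → ZMod 2) :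
    ∑ x, suppInd f x = Fintype.card V * relWeight f := by
  rw [relWeight]; field_simp [(card_pos_real (V := V)).ne']

theorem sum_suppInd_sub_sq [Fintype V] [Nonempty V] (f : V → ZMod 2) :
    ∑ x, (suppInd f x - relWeight f) ^ 2 =
      Fintype.card V * (relWeight f * (1 - relWeight f)) := by
  have : ∀ x, (suppInd f x - relWeight f) ^ 2 =
      suppInd f x - 2 * relWeight f * suppInd f x + relWeight f ^ 2 := fun x => by
    rw [sub_sq, suppInd_sq]; ring
  simp_rw [this]
  rw [Finset.sum_add_distrib, Finset.sum_sub_distrib, ← Finset.mul_sum, sum_suppInd]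
  simp only [Finset.sum_const, Finset.card_univ, nsmul_eq_mul]
  ring

open Classical in
/-- The elements of relative weight at most `w` in a group of functions. -/
noncomputable def lowWeight [Fintype V] (B : AddSubgroup (V → ZMod 2)) (w : ℝ) :
    Finset (V → ZMod 2) :=
  {f | f ∈ B ∧ relWeight f ≤ w}

theorem mem_lowWeight [Fintype V] {B : AddSubgroup (V → ZMod 2)} {w : ℝ} {f : V → ZMod 2} :
    f ∈ lowWeight B w ↔ f ∈ B ∧ relWeight f ≤ w := by
  simp [lowWeight]

/-! ### Cube averages and directional derivatives. -/

variable [AddCommGroup V]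

/-- The average of `F` over the cube `x + {0, v₁} + ⋯ + {0, v_t}`. -/
noncomputable def cubeAvg : (t : ℕ) → (Fin t → V) → (V → ℝ) → V → ℝ
  | 0, _, F => F
  | t + 1, v, F => cubeAvg t (Fin.tail v) fun x => (F x + F (x + v 0)) / 2

/-- The derivative in direction `v`. -/
def dirDeriv (v : V) : (V → ZMod 2) →+ (V → ZMod 2) where
  toFun f x := f (x + v) - f x
  map_zero' := by ext; simp
  map_add' f g := by ext; simp only [Pi.add_apply]; ring

@[simp] theorem dirDeriv_apply (v : V) (f : V → ZMod 2) (x : V) :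
    dirDeriv v f x = f (x + v) - f x := rfl

/-- The functions all of whose `j`-fold derivatives along distinct directions `v i` vanish. -/
def cubeKernel : (t j : ℕ) → (Fin t → V) → AddSubgroup (V → ZMod 2)
  | _, 0, _ => ⊥
  | 0, _ + 1, _ => ⊤
  | t + 1, j + 1, v =>
    cubeKernel t (j + 1) (Fin.tail v) ⊓ (cubeKernel t j (Fin.tail v)).comap (dirDeriv (v 0))

theorem suppInd_dirDeriv_le (v : V) (f : V → ZMod 2) (x : V) :
    suppInd (dirDeriv v f) x ≤ suppInd f x + suppInd f (x + v) := by
  rw [add_comm]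
  exact suppInd_sub_le (fun y => f (y + v)) f x

theorem cubeAvg_mono (t : ℕ) (v : Fin t → V) {F G : V → ℝ} (h : ∀ x, F x ≤ G x) (x : V) :
    cubeAvg t v F x ≤ cubeAvg t v G x := by
  induction t generalizing F G with
  | zero => exact h x
  | succ t ih => exact ih _ fun y => by linarith [h y, h (y + v 0)]

theorem cubeAvg_add (t : ℕ) (v : Fin t → V) (F G : V → ℝ) (x : V) :
    cubeAvg t v (fun y => F y + G y) x = cubeAvg t v F x + cubeAvg t v G x := by
  induction t generalizing F G with
  | zero => rfl
  | succ t ih =>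
    simp only [cubeAvg]
    rw [← ih]
    congr 1
    ext y; ring

theorem cubeAvg_const_mul (t : ℕ) (v : Fin t → V) (c : ℝ) (F : V → ℝ) (x : V) :
    cubeAvg t v (fun y => c * F y) x = c * cubeAvg t v F x := by
  induction t generalizing F with
  | zero => rfl
  | succ t ih =>
    simp only [cubeAvg]
    rw [← ih]
    congr 1
    ext y; ring

theorem cubeAvg_const (t : ℕ) (v : Fin t → V) (c : ℝ) (x : V) :
    cubeAvg t v (fun _ => c) x = c := by
  induction t with
  | zero => rfl
  | succ t ih => simpa [cubeAvg] using ih (Fin.tail v)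

theorem cubeAvg_translate (t : ℕ) (v : Fin t → V) (F : V → ℝ) (a x : V) :
    cubeAvg t v (fun y => F (y + a)) x = cubeAvg t v F (x + a) := by
  induction t generalizing F with
  | zero => rfl
  | succ t ih =>
    simp only [cubeAvg]
    rw [← ih]
    congr 1
    ext y; simp only [add_right_comm]

theorem mem_cubeKernel_one (t : ℕ) (v : Fin t → V) {g : V → ZMod 2}
    (hg : ∀ i x, g (x + v i) = g x) : g ∈ cubeKernel t 1 v := by
  induction t with
  | zero => simp [cubeKernel]
  | succ t ih =>
    simp only [cubeKernel, AddSubgroup.mem_inf, AddSubgroup.mem_comap]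
    refine ⟨ih _ fun i x => hg i.succ x, ?_⟩
    have : dirDeriv (v 0) g = 0 := by ext x; simp [hg 0 x]
    rw [this]; exact zero_mem _

/-- A nonzero value at the base point of a function in the cube kernel forces a large cube
average: this is the minimum distance of Reed-Muller codes on the cube. -/
theorem two_le_pow_mul_cubeAvg (t j : ℕ) (v : Fin t → V) {g : V → ZMod 2}
    (hg : g ∈ cubeKernel t j v) {x : V} (hx : g x ≠ 0) :
    2 ≤ 2 ^ j * cubeAvg t v (suppInd g) x := by
  induction t generalizing g j x with
  | zero =>
    cases j with
    | zero =>
      simp only [cubeKernel, AddSubgroup.mem_bot] at hg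
      subst hg; simp at hx
    | succ j =>
      have : (1 : ℝ) ≤ 2 ^ j := one_le_pow₀ (by norm_num)
      simp only [cubeAvg, suppInd, hx, if_false, pow_succ]
      linarith
  | succ t ih =>
    cases j with
    | zero =>
      simp only [cubeKernel, AddSubgroup.mem_bot] at hg
      subst hg; simp at hx
    | succ j =>
      simp only [cubeKernel, AddSubgroup.mem_inf, AddSubgroup.mem_comap] at hg
      by_cases hxv : g (x + v 0) = 0
      -- The derivative is nonzero at `x` and lies in the kernel for `j` instead of `j + 1`. Passing
      -- to it at most doubles the support, which the factor `2 ^ j` in place of `2 ^ (j + 1)`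
      -- compensates.
      · have h1 := ih j (Fin.tail v) hg.2 (x := x) (by simpa [hxv] using hx)
        have h2 : cubeAvg t (Fin.tail v) (fun y => (1 / 2) * suppInd (dirDeriv (v 0) g) y) x ≤
            cubeAvg (t + 1) v (suppInd g) x :=
          cubeAvg_mono _ _ (fun y => by linarith [suppInd_dirDeriv_le (v 0) g y]) x
        rw [cubeAvg_const_mul] at h2
        have : (0 : ℝ) < 2 ^ j := by positivity
        rw [pow_succ]
        nlinarith
      · have h1 := ih (j + 1) (Fin.tail v) hg.1 hx
        have h2 := ih (j + 1) (Fin.tail v) hg.1 hxv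
        have h3 : cubeAvg (t + 1) v (suppInd g) x =
            1 / 2 * cubeAvg t (Fin.tail v) (suppInd g) x +
              1 / 2 * cubeAvg t (Fin.tail v) (suppInd g) (x + v 0) := by
          rw [← cubeAvg_translate, ← cubeAvg_const_mul, ← cubeAvg_const_mul, ← cubeAvg_add]
          simp only [cubeAvg]
          congr 1
          ext y; ring
        rw [h3]
        linarith

variable [Fintype V]

theorem sum_comp_add_right (F : V → ℝ) (a : V) : ∑ x, F (x + a) = ∑ x, F x :=
  Equiv.sum_comp (Equiv.addRight a) F

/-- Averaging a function of mean zero along random directions halves its second moment for each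
direction. -/
theorem sum_sum_cubeAvg_sq (t : ℕ) {F : V → ℝ} (hF : ∑ x, F x = 0) :
    2 ^ t * ∑ v : Fin t → V, ∑ x, cubeAvg t v F x ^ 2 =
      (Fintype.card V : ℝ) ^ t * ∑ x, F x ^ 2 := by
  induction t generalizing F with
  | zero => simp [cubeAvg]
  | succ t ih =>
    rw [← (Fin.consEquiv fun _ => V).sum_comp, Fintype.sum_prod_type]
    have htail (p : V × (Fin t → V)) : Fin.tail (Fin.consEquiv (fun _ => V) p) = p.2 := rfl
    simp only [Fin.consEquiv_apply, cubeAvg, Fin.cons_zero, htail]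
    have h1 (a : V) : 2 ^ t * ∑ v : Fin t → V,
        ∑ x, cubeAvg t v (fun x => (F x + F (x + a)) / 2) x ^ 2 =
        (Fintype.card V : ℝ) ^ t * ∑ x, ((F x + F (x + a)) / 2) ^ 2 := by
      apply ih
      rw [← Finset.sum_div, Finset.sum_add_distrib, sum_comp_add_right, hF]; simp
    have h2 (a : V) : ∑ x, ((F x + F (x + a)) / 2) ^ 2 =
        1 / 2 * ∑ x, F x ^ 2 + 1 / 2 * ∑ x, F x * F (x + a) := by
      have : ∑ x, ((F x + F (x + a)) / 2) ^ 2 = 1 / 4 * ∑ x, F x ^ 2 +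
          1 / 4 * ∑ x, F (x + a) ^ 2 + 1 / 2 * ∑ x, F x * F (x + a) := by
        rw [Finset.mul_sum, Finset.mul_sum, Finset.mul_sum, ← Finset.sum_add_distrib,
          ← Finset.sum_add_distrib]
        exact Finset.sum_congr rfl fun x _ => by ring
      rw [this, sum_comp_add_right (fun x => F x ^ 2)]; ring
    -- For fixed `x` the translate `x + a` is uniform, so the cross terms factor through the mean of
    -- `F`.
    have h3 : ∑ a, ∑ x, F x * F (x + a) = 0 := by
      rw [Finset.sum_comm]
      refine Finset.sum_eq_zero fun x _ => ?_
      rw [← Finset.mul_sum, show ∑ a, F (x + a) = ∑ a, F a from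
        Equiv.sum_comp (Equiv.addLeft x) F, hF, mul_zero]
    calc _ = 2 * ∑ a, (2 ^ t * ∑ v : Fin t → V,
            ∑ x, cubeAvg t v (fun x => (F x + F (x + a)) / 2) x ^ 2) := by
          rw [← Finset.mul_sum]; ring
      _ = 2 * ((Fintype.card V : ℝ) ^ t * ∑ a, (1 / 2 * ∑ x, F x ^ 2 +
            1 / 2 * ∑ x, F x * F (x + a))) := by
          simp_rw [h1, h2]; rw [← Finset.mul_sum]
      _ = _ := by
          rw [Finset.sum_add_distrib, ← Finset.mul_sum (f := fun a => ∑ x, F x * F (x + a)), h3]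
          simp only [Finset.sum_const, Finset.card_univ, nsmul_eq_mul]
          ring

/-! ### Counting light words by their derivatives. -/

theorem relWeight_dirDeriv_le (v : V) (f : V → ZMod 2) :
    relWeight (dirDeriv v f) ≤ 2 * relWeight f := by
  have h := Finset.sum_le_sum fun x (_ : x ∈ Finset.univ) => suppInd_dirDeriv_le v f x
  rw [Finset.sum_add_distrib, sum_comp_add_right, sum_suppInd, sum_suppInd] at h
  have := card_pos_real (V := V)
  nlinarith

/-- The base points at which the cube average of the support of `f` is at least `θ`. -/
noncomputable def heavyPoints (t : ℕ) (v : Fin t → V) (θ : ℝ) (f : V → ZMod 2) : Finset V :=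
  open Classical in {x | θ ≤ cubeAvg t v (suppInd f) x}

/-- Chebyshev's inequality: at a heavy point the cube average exceeds its mean by `d`, and its
variance is the Bernoulli variance divided by `2 ^ t`. -/
theorem sum_card_heavyPoints_le (t : ℕ) {θ d σ : ℝ} (hd : 0 < d) (f : V → ZMod 2)
    (hθ : relWeight f + d ≤ θ) (hσ : relWeight f * (1 - relWeight f) ≤ σ) :
    ∑ v : Fin t → V, ((heavyPoints t v θ f).card : ℝ) ≤
      (Fintype.card V : ℝ) ^ t * (Fintype.card V * (σ / (2 ^ t * d ^ 2))) := by
  classical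
  have hmean : ∑ x, (suppInd f x - relWeight f) = 0 := by
    rw [Finset.sum_sub_distrib, sum_suppInd]; simp
  have hvar := sum_sum_cubeAvg_sq t hmean
  rw [sum_suppInd_sub_sq] at hvar
  have hpt (v : Fin t → V) : ((heavyPoints t v θ f).card : ℝ) * d ^ 2 ≤
      ∑ x, cubeAvg t v (fun x => suppInd f x - relWeight f) x ^ 2 := by
    rw [← nsmul_eq_mul, ← Finset.sum_const]
    refine (Finset.sum_le_sum fun x hx => ?_).trans
      (Finset.sum_le_univ_sum_of_nonneg fun x => sq_nonneg _)
    have hx' : θ ≤ cubeAvg t v (suppInd f) x := by simpa [heavyPoints] using hx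
    have : cubeAvg t v (fun x => suppInd f x - relWeight f) x =
        cubeAvg t v (suppInd f) x - relWeight f := by
      simp only [sub_eq_add_neg]
      rw [cubeAvg_add, cubeAvg_const]
    rw [this]
    exact pow_le_pow_left₀ hd.le (by linarith) 2
  have hsum := Finset.sum_le_sum fun v (_ : v ∈ Finset.univ) => hpt v
  rw [← Finset.sum_mul] at hsum
  have h2 : (0 : ℝ) < 2 ^ t := by positivity
  have hc := card_pos_real (V := V)
  have : (∑ v : Fin t → V, ((heavyPoints t v θ f).card : ℝ)) * (2 ^ t * d ^ 2) ≤
      (Fintype.card V : ℝ) ^ t * (Fintype.card V * σ) := by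
    calc _ = 2 ^ t * ((∑ v : Fin t → V, ((heavyPoints t v θ f).card : ℝ)) * d ^ 2) := by ring
      _ ≤ _ := mul_le_mul_of_nonneg_left hsum h2.le
      _ = _ := hvar
      _ ≤ _ := by gcongr
  have h3 : (0 : ℝ) < 2 ^ t * d ^ 2 := by positivity
  rw [← le_div_iff₀ h3] at this
  refine this.trans (le_of_eq ?_)
  ring

/-- Where `f - g` is nonzero, its cube average is at least `2 / 2 ^ j`, and this is at most the sum
of the averages of `f` and `g`; hence one of them reaches `θ`. -/
theorem relWeight_sub_le_of_cubeKernel (t j : ℕ) (v : Fin t → V) {f g : V → ZMod 2} {θ : ℝ}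
    (hθ : 2 ^ j * θ ≤ 1) (hfg : f - g ∈ cubeKernel t j v) :
    Fintype.card V * relWeight (f - g) ≤
      (heavyPoints t v θ f).card + (heavyPoints t v θ g).card := by
  classical
  have hsub : (Finset.univ.filter fun x => (f - g) x ≠ 0) ⊆
      heavyPoints t v θ f ∪ heavyPoints t v θ g := by
    intro x hx
    have hx' : (f - g) x ≠ 0 := by simpa using hx
    have h1 := two_le_pow_mul_cubeAvg t j v hfg hx'
    have h2 := cubeAvg_mono t v (suppInd_sub_le f g) x
    rw [cubeAvg_add] at h2
    by_contra hcon
    simp only [heavyPoints, Finset.mem_union, Finset.mem_filter, Finset.mem_univ, true_and,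
      not_or, not_le] at hcon
    have : (0 : ℝ) < 2 ^ j := by positivity
    nlinarith [hcon.1, hcon.2]
  have h := (Finset.card_le_card hsub).trans (Finset.card_union_le _ _)
  have h3 : Fintype.card V * relWeight (f - g) =
      ((Finset.univ.filter fun x => (f - g) x ≠ 0).card : ℝ) := by
    rw [← sum_suppInd, Finset.card_filter]
    push_cast
    exact Finset.sum_congr rfl fun x _ => by unfold suppInd; split_ifs <;> simp_all
  rw [h3]
  exact_mod_cast h

/-- Within a coset of `U`, subtracting one fixed member of `S` embeds the other members into `T`. -/
theorem card_le_relIndex_mul {G : Type*} [AddCommGroup G] [Finite G] [DecidableEq G]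
    (U B : AddSubgroup G) (S T : Finset G) (hS : ∀ f ∈ S, f ∈ B)
    (hST : ∀ f ∈ S, ∀ g ∈ S, f - g ∈ U → f - g ∈ T) :
    S.card ≤ T.card * U.relIndex B := by
  classical
  have : Fintype G := Fintype.ofFinite G
  let Q : S → B ⧸ U.addSubgroupOf B := fun f =>
    QuotientAddGroup.mk (⟨f.1, hS f.1 f.2⟩ : B)
  have : Fintype (B ⧸ U.addSubgroupOf B) := Fintype.ofFinite _
  have h1 := Finset.card_le_mul_card_image (f := Q) Finset.univ T.card (by
    intro b hb
    obtain ⟨g, -, rfl⟩ := Finset.mem_image.1 hb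
    refine Finset.card_le_card_of_injOn (fun f => f.1 - g.1) ?_ ?_
    · intro f hf
      simp only [Finset.coe_filter, Finset.mem_univ, true_and, Set.mem_ofPred_eq] at hf
      refine hST _ f.2 _ g.2 ?_
      have := QuotientAddGroup.eq.1 hf.symm
      rw [AddSubgroup.mem_addSubgroupOf] at this
      simpa [sub_eq_add_neg, add_comm] using this
    · intro a _ b _ hab
      exact Subtype.ext (sub_left_injective hab))
  rw [Finset.card_univ, Fintype.card_coe] at h1
  refine h1.trans (Nat.mul_le_mul_left _ ?_)
  rw [AddSubgroup.relIndex, AddSubgroup.index, Nat.card_eq_fintype_card]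
  exact Finset.card_le_univ _

/-- The number of light codewords is controlled by the number of much lighter codewords and the
amount of information carried by the `j`-fold derivatives along `t` directions. -/
theorem card_lowWeight_le (B : AddSubgroup (V → ZMod 2)) (t j I : ℕ)
    (hI : ∀ v : Fin t → V, (cubeKernel t j v).relIndex B ≤ I) {w w' d σ : ℝ} (hd : 0 < d)
    (hw : 2 ^ j * (w + d) ≤ 1)
    (hσ : ∀ f ∈ lowWeight B w, relWeight f * (1 - relWeight f) ≤ σ)
    (hw' : 4 * (σ / (2 ^ t * d ^ 2)) ≤ w') :
    (lowWeight B w).card ≤ 2 * (I * (lowWeight B w').card) := by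
  classical
  set η := σ / (2 ^ t * d ^ 2) with hη
  have hc := card_pos_real (V := V)
  rcases (lowWeight B w).eq_empty_or_nonempty with he | ⟨f₀, hf₀⟩
  · simp [he]
  -- The threshold is twice the Markov mean, so at least half of all direction tuples are good for
  -- any given `f`. This is the source of the factor `2` in the conclusion.
  let good (v : Fin t → V) (f : V → ZMod 2) : Prop :=
    ((heavyPoints t v (w + d) f).card : ℝ) ≤ 2 * (Fintype.card V * η)
  have hη0 : 0 ≤ η := by
    have : 0 ≤ σ := le_trans (mul_nonneg (relWeight_nonneg f₀)
      (sub_nonneg.2 (relWeight_le_one f₀))) (hσ f₀ hf₀)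
    positivity
  have hgood (f) (hf : f ∈ lowWeight B w) : (Fintype.card V : ℝ) ^ t ≤
      2 * ((Finset.univ.filter fun v => good v f).card : ℝ) := by
    have h := sum_card_heavyPoints_le t (θ := w + d) hd f
      (by linarith [(mem_lowWeight.1 hf).2]) (hσ f hf)
    rw [← hη] at h
    -- When `η = 0` Markov's inequality gives nothing, but then no tuple has any heavy points.
    rcases hη0.eq_or_lt with h0 | h0
    · have hall : ∀ v, good v f := by
        intro v
        have h' := (Finset.single_le_sum (f := fun v : Fin t → V =>
          ((heavyPoints t v (w + d) f).card : ℝ)) (fun _ _ => Nat.cast_nonneg _)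
          (Finset.mem_univ v)).trans h
        simp only [good]
        rw [← h0] at h' ⊢
        simpa using h'
      rw [Finset.filter_true_of_mem fun v _ => hall v]
      simp only [Finset.card_univ, Fintype.card_fun, Fintype.card_fin, Nat.cast_pow]
      have : (0 : ℝ) ≤ (Fintype.card V : ℝ) ^ t := by positivity
      linarith
    · have hbad : ((Finset.univ.filter fun v => ¬ good v f).card : ℝ) *
          (2 * (Fintype.card V * η)) ≤ (Fintype.card V : ℝ) ^ t * (Fintype.card V * η) := by
        refine le_trans ?_ h
        rw [← nsmul_eq_mul, ← Finset.sum_const]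
        refine (Finset.sum_le_sum fun v hv => ?_).trans
          (Finset.sum_le_univ_sum_of_nonneg fun v => Nat.cast_nonneg _)
        exact (not_le.1 (Finset.mem_filter.1 hv).2).le
      have hsum : ((Finset.univ.filter fun v => good v f).card : ℝ) +
          ((Finset.univ.filter fun v => ¬ good v f).card : ℝ) = (Fintype.card V : ℝ) ^ t := by
        have := Finset.card_filter_add_card_filter_not (s := (Finset.univ : Finset (Fin t → V)))
          (fun v => good v f)
        rw [Finset.card_univ, Fintype.card_fun, Fintype.card_fin] at this
        exact_mod_cast this
      have hpos : 0 < Fintype.card V * η := mul_pos hc h0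
      have : 2 * ((Finset.univ.filter fun v => ¬ good v f).card : ℝ) ≤
          (Fintype.card V : ℝ) ^ t := by
        refine le_of_mul_le_mul_right ?_ hpos
        linarith
      linarith
  have hv (v : Fin t → V) : ((lowWeight B w).filter fun f => good v f).card ≤
      I * (lowWeight B w').card := by
    refine (card_le_relIndex_mul (cubeKernel t j v) B _ (lowWeight B w') ?_ ?_).trans ?_
    · intro f hf
      exact (mem_lowWeight.1 (Finset.mem_filter.1 hf).1).1
    · intro f hf g hg hfg
      obtain ⟨hf1, hf2⟩ := Finset.mem_filter.1 hf
      obtain ⟨hg1, hg2⟩ := Finset.mem_filter.1 hg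
      refine mem_lowWeight.2 ⟨sub_mem (mem_lowWeight.1 hf1).1 (mem_lowWeight.1 hg1).1, ?_⟩
      have h1 := relWeight_sub_le_of_cubeKernel t j v hw hfg
      refine le_trans ?_ hw'
      refine le_of_mul_le_mul_left ?_ hc
      simp only [good] at hf2 hg2
      linarith
    · rw [mul_comm]; exact Nat.mul_le_mul_right _ (hI v)
  have hdouble : ∑ f ∈ lowWeight B w, ((Finset.univ.filter fun v => good v f).card : ℝ) =
      ∑ v : Fin t → V, (((lowWeight B w).filter fun f => good v f).card : ℝ) := by
    simp only [Finset.card_filter, Nat.cast_sum]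
    exact Finset.sum_comm
  have hfinal : ((lowWeight B w).card : ℝ) * (Fintype.card V : ℝ) ^ t ≤
      2 * ((Fintype.card V : ℝ) ^ t * (I * (lowWeight B w').card)) := by
    calc _ = ∑ f ∈ lowWeight B w, (Fintype.card V : ℝ) ^ t := by simp
      _ ≤ ∑ f ∈ lowWeight B w, 2 * ((Finset.univ.filter fun v => good v f).card : ℝ) :=
        Finset.sum_le_sum hgood
      _ = 2 * ∑ v : Fin t → V, (((lowWeight B w).filter fun f => good v f).card : ℝ) := by
        rw [← Finset.mul_sum, hdouble]
      _ ≤ 2 * ∑ v : Fin t → V, ((I * (lowWeight B w').card : ℕ) : ℝ) := by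
        gcongr with v; exact_mod_cast hv v
      _ = _ := by simp
  have hct : (0 : ℝ) < (Fintype.card V : ℝ) ^ t := by positivity
  have : ((lowWeight B w).card : ℝ) ≤ 2 * (I * (lowWeight B w').card) := by
    refine le_of_mul_le_mul_right ?_ hct
    linarith
  exact_mod_cast this

end Cube

/-! ### Reed-Muller codes: dimension, derivatives, minimum distance. -/

section ReedMullerSpan

/-- The function `x ↦ ∏ i ∈ S, x i` on `𝔽₂ᵐ`. -/
def monoEval {m : ℕ} (S : Finset (Fin m)) (x : Fin m → ZMod 2) : ZMod 2 := ∏ i ∈ S, x i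

/-- The span of the squarefree monomials of degree less than `n`. -/
noncomputable def rmSpan (m n : ℕ) : Submodule (ZMod 2) ((Fin m → ZMod 2) → ZMod 2) :=
  Submodule.span (ZMod 2) (monoEval '' {S : Finset (Fin m) | S.card < n})

/-- The dimension of the Reed-Muller code spanned by the monomials of degree less than `n`. -/
def rmDim (m n : ℕ) : ℕ := ∑ i ∈ Finset.range n, m.choose i

theorem monoEval_mem_rmSpan {m n : ℕ} {S : Finset (Fin m)} (hS : S.card < n) :
    monoEval S ∈ rmSpan m n :=
  Submodule.subset_span ⟨S, hS, rfl⟩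

theorem rmSpan_zero (m : ℕ) : rmSpan m 0 = ⊥ := by
  simp [rmSpan]

theorem rmSpan_mono (m : ℕ) {n n' : ℕ} (h : n ≤ n') : rmSpan m n ≤ rmSpan m n' :=
  Submodule.span_mono (Set.image_mono fun _ hS => lt_of_lt_of_le hS h)

theorem reedMuller_eq_rmSpan (m r : ℕ) : reedMuller m r = rmSpan m (r + 1) := by
  apply le_antisymm
  · intro c hc
    obtain ⟨f, hf, hcf⟩ := mem_reedMuller.1 hc
    have hc' : c = ∑ d ∈ f.support, f.coeff d • monoEval d.support := by
      ext a
      rw [hcf, MvPolynomial.eval_eq]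
      simp only [Finset.sum_apply, Pi.smul_apply, smul_eq_mul, monoEval]
      refine Finset.sum_congr rfl fun d _ => ?_
      congr 1
      refine Finset.prod_congr rfl fun i hi => ?_
      have h0 : d i ≠ 0 := Finsupp.mem_support_iff.1 hi
      generalize a i = b
      fin_cases b
      · exact zero_pow h0
      · exact one_pow _
    rw [hc']
    refine Submodule.sum_mem _ fun d hd => Submodule.smul_mem _ _ (monoEval_mem_rmSpan ?_)
    have h1 : d.support.card ≤ d.sum fun _ e => e := by
      rw [Finset.card_eq_sum_ones]
      exact Finset.sum_le_sum fun i hi => Nat.one_le_iff_ne_zero.2 (Finsupp.mem_support_iff.1 hi)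
    exact Nat.lt_succ_of_le (h1.trans ((MvPolynomial.le_totalDegree hd).trans hf))
  · refine Submodule.span_le.2 ?_
    rintro _ ⟨S, hS, rfl⟩
    refine mem_reedMuller.2 ⟨∏ i ∈ S, MvPolynomial.X i, ?_, fun a => by simp [monoEval]⟩
    refine (MvPolynomial.totalDegree_finsetProd _ _).trans ?_
    simp only [MvPolynomial.totalDegree_X, Finset.sum_const, smul_eq_mul, mul_one]
    exact Nat.lt_succ_iff.1 hS

theorem span_range_monoEval (m : ℕ) :
    ⊤ ≤ Submodule.span (ZMod 2) (Set.range (monoEval (m := m))) := by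
  classical
  intro f _
  have hind (a : Fin m → ZMod 2) : (fun x => if x = a then (1 : ZMod 2) else 0) ∈
      Submodule.span (ZMod 2) (Set.range (monoEval (m := m))) := by
    -- The indicator of `a` is `∏ i, (x i + a i + 1)`, expanded into monomials.
    have : (fun x => if x = a then (1 : ZMod 2) else 0) =
        ∑ S ∈ (Finset.univ : Finset (Fin m)).powerset,
          (∏ i ∈ Finset.univ \ S, (a i + 1)) • monoEval S := by
      ext x
      simp only [Finset.sum_apply, Pi.smul_apply, smul_eq_mul, monoEval]
      have h := Finset.prod_add (fun i => x i) (fun i => a i + 1) Finset.univ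
      simp_rw [mul_comm (∏ i ∈ _ \ _, _)]
      rw [← h]
      split_ifs with hx
      · subst hx
        refine (Finset.prod_eq_one fun i _ => ?_).symm
        generalize x i = b
        revert b; decide
      · obtain ⟨i, hi⟩ := Function.ne_iff.1 hx
        refine (Finset.prod_eq_zero (Finset.mem_univ i) ?_).symm
        revert hi
        generalize x i = b
        generalize a i = c
        revert b c; decide
    rw [this]
    exact Submodule.sum_mem _ fun S _ => Submodule.smul_mem _ _ (Submodule.subset_span ⟨S, rfl⟩)
  have hf : f = ∑ a, f a • fun x => if x = a then (1 : ZMod 2) else 0 := by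
    ext x; simp
  rw [hf]
  exact Submodule.sum_mem _ fun a _ => Submodule.smul_mem _ _ (hind a)

theorem linearIndependent_monoEval (m : ℕ) :
    LinearIndependent (ZMod 2) (monoEval (m := m)) :=
  linearIndependent_of_top_le_span_of_card_eq_finrank (span_range_monoEval m) (by simp)

theorem finrank_rmSpan (m n : ℕ) : Module.finrank (ZMod 2) (rmSpan m n) = rmDim m n := by
  classical
  have hli : LinearIndependent (ZMod 2)
      fun S : {S : Finset (Fin m) // S.card < n} => monoEval S.1 :=
    (linearIndependent_monoEval m).comp _ Subtype.val_injective
  have hr : rmSpan m n = Submodule.span (ZMod 2)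
      (Set.range fun S : {S : Finset (Fin m) // S.card < n} => monoEval S.1) := by
    rw [rmSpan]; congr 1; ext f; simp
  rw [hr, finrank_span_eq_card hli, Fintype.card_subtype, rmDim]
  have h1 : (Finset.univ.filter fun S : Finset (Fin m) => S.card < n) =
      (Finset.range n).biUnion fun i => Finset.powersetCard i Finset.univ := by
    ext S; simp [Finset.mem_powersetCard]
  rw [h1, Finset.card_biUnion]
  · simp
  · intro i _ j _ hij
    exact Finset.pairwise_disjoint_powersetCard _ hij

theorem natCard_rmSpan (m n : ℕ) : Nat.card (rmSpan m n) = 2 ^ rmDim m n := by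
  rw [Module.natCard_eq_pow_finrank (K := ZMod 2), finrank_rmSpan, Nat.card_zmod]

theorem dirDeriv_mem_rmSpan {m n : ℕ} (v : Fin m → ZMod 2) {f : (Fin m → ZMod 2) → ZMod 2}
    (hf : f ∈ rmSpan m n) : dirDeriv v f ∈ rmSpan m (n - 1) := by
  classical
  refine Submodule.span_induction (p := fun f _ => dirDeriv v f ∈ rmSpan m (n - 1)) ?_ ?_ ?_ ?_ hf
  · rintro _ ⟨S, hS, rfl⟩
    have : dirDeriv v (monoEval S) =
        ∑ T ∈ S.powerset.erase S, (∏ i ∈ S \ T, v i) • monoEval T := by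
      ext x
      simp only [dirDeriv_apply, Finset.sum_apply, Pi.smul_apply, smul_eq_mul, monoEval,
        Pi.add_apply]
      rw [Finset.prod_add, ← Finset.add_sum_erase _ _ (Finset.mem_powerset_self S)]
      simp [mul_comm]
    rw [this]
    refine Submodule.sum_mem _ fun T hT => Submodule.smul_mem _ _ (monoEval_mem_rmSpan ?_)
    obtain ⟨hne, hsub⟩ := Finset.mem_erase.1 hT
    have := Finset.card_lt_card (Finset.ssubset_iff_subset_ne.2 ⟨Finset.mem_powerset.1 hsub, hne⟩)
    have hS' : S.card < n := hS
    omega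
  · rw [map_zero]; exact zero_mem _
  · intro f g _ _ hf hg
    rw [map_add]; exact add_mem hf hg
  · intro a f _ hf
    have : dirDeriv v (a • f) = a • dirDeriv v f := by ext x; simp [mul_sub]
    rw [this]; exact Submodule.smul_mem _ _ hf

theorem linear_mul_mem_rmSpan {m n : ℕ} (L : (Fin m → ZMod 2) →ₗ[ZMod 2] ZMod 2)
    {f : (Fin m → ZMod 2) → ZMod 2} (hf : f ∈ rmSpan m n) :
    (fun x => L x * f x) ∈ rmSpan m (n + 1) := by
  classical
  have hcoord (j : Fin m) : (fun x : Fin m → ZMod 2 => x j * f x) ∈ rmSpan m (n + 1) := by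
    refine Submodule.span_induction
      (p := fun f _ => (fun x : Fin m → ZMod 2 => x j * f x) ∈ rmSpan m (n + 1)) ?_ ?_ ?_ ?_ hf
    · rintro _ ⟨S, hS, rfl⟩
      have hS' : S.card < n := hS
      by_cases hj : j ∈ S
      · have : (fun x : Fin m → ZMod 2 => x j * monoEval S x) = monoEval S := by
          ext x
          simp only [monoEval]
          rw [← Finset.mul_prod_erase S (fun i => x i) hj, ← mul_assoc]
          congr 1
          generalize x j = b
          revert b; decide
        rw [this]
        exact monoEval_mem_rmSpan (by omega)
      · have : (fun x : Fin m → ZMod 2 => x j * monoEval S x) = monoEval (insert j S) := by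
          ext x
          simp only [monoEval]
          rw [Finset.prod_insert hj]
        rw [this]
        exact monoEval_mem_rmSpan (by rw [Finset.card_insert_of_notMem hj]; omega)
    · have : (fun x : Fin m → ZMod 2 => x j * (0 : (Fin m → ZMod 2) → ZMod 2) x) = 0 := by
        ext; simp
      rw [this]; exact zero_mem _
    · intro f g _ _ hf hg
      convert add_mem hf hg using 1
      ext x; simp [mul_add]
    · intro a f _ hf
      convert Submodule.smul_mem _ a hf using 1
      ext x; simp; ring
  have : (fun x => L x * f x) = ∑ j, L (Pi.single j 1) • fun x : Fin m → ZMod 2 => x j * f x := by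
    ext x
    simp only [Finset.sum_apply, Pi.smul_apply, smul_eq_mul]
    rw [L.pi_apply_eq_sum_univ x, Finset.sum_mul]
    refine Finset.sum_congr rfl fun j _ => ?_
    have : (fun k => if j = k then (1 : ZMod 2) else 0) = Pi.single j 1 := by
      ext k; simp [Pi.single_apply, eq_comm]
    rw [this, smul_eq_mul]; ring
  rw [this]
  exact Submodule.sum_mem _ fun j _ => Submodule.smul_mem _ _ (hcoord j)

theorem comp_linear_mem_rmSpan {m m' n : ℕ} (P : (Fin m → ZMod 2) →ₗ[ZMod 2] (Fin m' → ZMod 2))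
    {f : (Fin m' → ZMod 2) → ZMod 2} (hf : f ∈ rmSpan m' n) : f ∘ P ∈ rmSpan m n := by
  classical
  refine Submodule.span_induction (p := fun f _ => f ∘ P ∈ rmSpan m n) ?_ ?_ ?_ ?_ hf
  · rintro _ ⟨S, hS, rfl⟩
    have key : monoEval S ∘ P ∈ rmSpan m (S.card + 1) := by
      clear hS
      induction S using Finset.induction_on with
      | empty =>
        have : monoEval (∅ : Finset (Fin m')) ∘ P = monoEval (∅ : Finset (Fin m)) := by
          ext x; simp [monoEval]
        rw [this]; exact monoEval_mem_rmSpan (by simp)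
      | insert j S hj ih =>
        have := linear_mul_mem_rmSpan ((LinearMap.proj j).comp P) ih
        rw [Finset.card_insert_of_notMem hj]
        convert this using 1
        ext x; simp [monoEval, Finset.prod_insert hj]
    exact rmSpan_mono m hS key
  · exact zero_mem _
  · intro f g _ _ hf hg
    exact add_mem hf hg
  · intro a f _ hf
    exact Submodule.smul_mem _ a hf

theorem dirDeriv_map_le (m n : ℕ) (v : Fin m → ZMod 2) :
    (rmSpan m n).toAddSubgroup.map (dirDeriv v) ≤ (rmSpan m (n - 1)).toAddSubgroup := by
  rintro _ ⟨f, hf, rfl⟩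
  exact dirDeriv_mem_rmSpan v hf

/-- There are `t.choose j` derivatives of order `j`, each in a code of degree lower by `j`. The
induction is Pascal's rule: use the first direction or not. -/
theorem relIndex_cubeKernel_le {m : ℕ} (n t j : ℕ) (v : Fin t → Fin m → ZMod 2) :
    (cubeKernel t j v).relIndex (rmSpan m n).toAddSubgroup ≤
      2 ^ (t.choose j * rmDim m (n - j)) := by
  induction t generalizing n j with
  | zero =>
    cases j with
    | zero =>
      simp only [cubeKernel, AddSubgroup.relIndex_bot_left, Nat.choose_self, one_mul, Nat.sub_zero]
      exact (natCard_rmSpan m n).le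
    | succ j => simp [cubeKernel]
  | succ t ih =>
    cases j with
    | zero =>
      simp only [cubeKernel, AddSubgroup.relIndex_bot_left, Nat.choose_zero_right, one_mul,
        Nat.sub_zero]
      exact (natCard_rmSpan m n).le
    | succ j =>
      rw [cubeKernel]
      refine (AddSubgroup.relIndex_inf_le).trans ?_
      rw [AddSubgroup.relIndex_comap, Nat.choose_succ_succ, add_mul, pow_add, mul_comm]
      refine Nat.mul_le_mul ?_ (ih n (j + 1) _)
      refine (AddSubgroup.relIndex_le_of_le_right (dirDeriv_map_le m n _)
        AddSubgroup.index_ne_zero_of_finite).trans ?_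
      refine (ih (n - 1) j _).trans ?_
      rw [Nat.sub_sub, add_comm 1 j]

theorem exists_surjective_linear_ker {m t : ℕ} (v : Fin t → Fin m → ZMod 2) :
    ∃ P : (Fin m → ZMod 2) →ₗ[ZMod 2] (Fin (m - t) → ZMod 2),
      Function.Surjective P ∧ ∀ i, P (v i) = 0 := by
  set W := Submodule.span (ZMod 2) (Set.range v) with hW
  have h1 : Module.finrank (ZMod 2) W ≤ t := by
    have := finrank_range_le_card (R := ZMod 2) v
    rwa [Fintype.card_fin] at this
  have h2 := W.finrank_quotient_add_finrank
  rw [Module.finrank_fin_fun] at h2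
  obtain ⟨J, hJ⟩ := (finrank_le_iff_exists_linearMap (R := ZMod 2)
    (M := Fin (m - t) → ZMod 2) (M' := (Fin m → ZMod 2) ⧸ W)).1
    (by rw [Module.finrank_fin_fun]; omega)
  obtain ⟨Q, hQ⟩ := J.exists_leftInverse_of_injective (LinearMap.ker_eq_bot.2 hJ)
  have hQs : Function.Surjective Q := fun y => ⟨J y, LinearMap.congr_fun hQ y⟩
  refine ⟨Q.comp W.mkQ, hQs.comp W.mkQ_surjective, fun i => ?_⟩
  have : W.mkQ (v i) = 0 := by
    rw [Submodule.mkQ_apply, Submodule.Quotient.mk_eq_zero]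
    exact Submodule.subset_span ⟨i, rfl⟩
  simp [this]

theorem rmDim_mono_left {m m' : ℕ} (n : ℕ) (h : m ≤ m') : rmDim m n ≤ rmDim m' n :=
  Finset.sum_le_sum fun _ _ => Nat.choose_le_choose _ h

/-- Codewords in `m - t` variables, pulled back along a surjection that kills every `v i`, are
invariant and so lie in the kernel. For large `t` this beats the general bound with `j = 1`, whose
exponent `t * rmDim m (n - 1)` can exceed the dimension of the code. -/
theorem relIndex_cubeKernel_one_le {m : ℕ} (n t : ℕ) (v : Fin t → Fin m → ZMod 2) :
    (cubeKernel t 1 v).relIndex (rmSpan m n).toAddSubgroup ≤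
      2 ^ (rmDim m n - rmDim (m - t) n) := by
  obtain ⟨P, hP, hv⟩ := exists_surjective_linear_ker v
  set U := (cubeKernel t 1 v).addSubgroupOf (rmSpan m n).toAddSubgroup with hU
  have hcard : 2 ^ rmDim (m - t) n ≤ Nat.card U := by
    rw [← natCard_rmSpan]
    refine Nat.card_le_card_of_injective
      (fun f => (⟨⟨f.1 ∘ P, comp_linear_mem_rmSpan P f.2⟩, ?_⟩ : U)) ?_
    · rw [AddSubgroup.mem_addSubgroupOf]
      refine mem_cubeKernel_one t v fun i x => ?_
      simp [hv]
    · intro f g hfg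
      have h : f.1 ∘ P = g.1 ∘ P := congrArg (fun u : U => u.1.1) hfg
      exact Subtype.ext (hP.injective_comp_right h)
  have hmul := U.card_mul_index
  have hc : Nat.card (rmSpan m n).toAddSubgroup = 2 ^ rmDim m n := natCard_rmSpan m n
  rw [hc, ← Nat.add_sub_cancel' (rmDim_mono_left n (Nat.sub_le m t)), pow_add] at hmul
  refine Nat.le_of_mul_le_mul_left (c := 2 ^ rmDim (m - t) n) ?_ (by positivity)
  rw [← hmul]
  exact Nat.mul_le_mul_right _ hcard

/-- A derivative lowers the degree and at most doubles the weight; a nonzero function with all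
derivatives zero is constantly `1`. -/
theorem two_le_pow_mul_relWeight {m n : ℕ} {f : (Fin m → ZMod 2) → ZMod 2}
    (hf : f ∈ rmSpan m n) (h0 : f ≠ 0) : 2 ≤ 2 ^ n * relWeight f := by
  induction n generalizing f with
  | zero => simp [rmSpan_zero] at hf; exact absurd hf h0
  | succ n ih =>
    by_cases hd : ∃ v, dirDeriv v f ≠ 0
    · obtain ⟨v, hv⟩ := hd
      have hmem := dirDeriv_mem_rmSpan v hf
      rw [Nat.add_sub_cancel] at hmem
      have h1 := ih hmem hv
      have h2 := relWeight_dirDeriv_le v f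
      calc (2 : ℝ) ≤ 2 ^ n * relWeight (dirDeriv v f) := h1
        _ ≤ 2 ^ n * (2 * relWeight f) := mul_le_mul_of_nonneg_left h2 (by positivity)
        _ = 2 ^ (n + 1) * relWeight f := by rw [pow_succ, mul_assoc]
    · obtain ⟨a, ha⟩ := Function.ne_iff.1 h0
      have hall (x) : suppInd f x = 1 := by
        refine if_neg fun hx => hd ⟨x - a, fun h => ha ?_⟩
        have := congrFun h a
        rw [dirDeriv_apply, add_sub_cancel, hx, zero_sub] at this
        exact neg_eq_zero.1 this
      have : relWeight f = 1 := by
        rw [relWeight]; simp_rw [hall]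
        simp
      rw [this, mul_one, pow_succ]
      have : (1 : ℝ) ≤ 2 ^ n := one_le_pow₀ (by norm_num)
      linarith

end ReedMullerSpan

/-! ### Weight distribution of Reed-Muller codes of low degree. -/

section WeightDistribution

/-- Consecutive binomials have ratio `(m - i) / (i + 1)`, which is at least `48` here: in terms of
the degree `r = n - 1` the hypothesis reads `49 * r ≤ m + 1`. -/
theorem mul_rmDim_pred_le {m n : ℕ} (h : 49 * n ≤ m + 50) :
    48 * rmDim m (n - 1) ≤ rmDim m n := by
  cases n with
  | zero => simp [rmDim]
  | succ r =>
    rw [Nat.add_sub_cancel, rmDim, rmDim, Finset.mul_sum, Finset.sum_range_succ']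
    refine le_trans (Finset.sum_le_sum fun i hi => ?_) (Nat.le_add_right _ _)
    have hi' := Finset.mem_range.1 hi
    have h1 := Nat.choose_succ_right_eq m i
    refine Nat.le_of_mul_le_mul_right (c := i + 1) ?_ (Nat.succ_pos i)
    rw [h1, mul_comm 48, mul_assoc]
    exact Nat.mul_le_mul_left _ (by omega)

theorem pow_mul_rmDim_sub_le {m n : ℕ} (j : ℕ) (h : 49 * n ≤ m + 50) :
    48 ^ j * rmDim m (n - j) ≤ rmDim m n := by
  induction j with
  | zero => simp
  | succ j ih =>
    have := mul_rmDim_pred_le (m := m) (n := n - j) (by omega)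
    rw [Nat.sub_sub] at this
    calc 48 ^ (j + 1) * rmDim m (n - (j + 1)) = 48 ^ j * (48 * rmDim m (n - (j + 1))) := by ring
      _ ≤ 48 ^ j * rmDim m (n - j) := Nat.mul_le_mul_left _ this
      _ ≤ _ := ih

theorem rmDim_succ_le (m n : ℕ) : rmDim (m + 1) n ≤ rmDim m n + rmDim m (n - 1) := by
  cases n with
  | zero => simp [rmDim]
  | succ r =>
    rw [Nat.add_sub_cancel, rmDim, rmDim, rmDim, Finset.sum_range_succ', Finset.sum_range_succ' _ r]
    simp only [Nat.choose_succ_succ', Finset.sum_add_distrib, Nat.choose_zero_right]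
    omega

/-- By Pascal's rule a new variable adds the dimension of the code of degree one less, hence a
factor of at most `1 + 1/48`. -/
theorem pow_mul_rmDim_add_le {m n : ℕ} (t : ℕ) (h : 49 * n ≤ m + 50) :
    48 ^ t * rmDim (m + t) n ≤ 49 ^ t * rmDim m n := by
  induction t with
  | zero => simp
  | succ t ih =>
    have h1 := rmDim_succ_le (m + t) n
    have h2 := mul_rmDim_pred_le (m := m + t) (n := n) (by omega)
    calc 48 ^ (t + 1) * rmDim (m + (t + 1)) n
        = 48 ^ t * (48 * rmDim (m + t + 1) n) := by rw [pow_succ, ← add_assoc]; ring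
      _ ≤ 48 ^ t * (49 * rmDim (m + t) n) := Nat.mul_le_mul_left _ (by omega)
      _ = 49 * (48 ^ t * rmDim (m + t) n) := by ring
      _ ≤ 49 * (49 ^ t * rmDim m n) := Nat.mul_le_mul_left _ ih
      _ = _ := by ring

/-- The binomials grow by at most `16/3` per step. Against the factor `48` gained per derivative
this leaves the decay `1/9`. -/
theorem pow_mul_choose_le (b : ℕ) : 3 ^ b * (2 * b + 7).choose (b + 1) ≤ 7 * 16 ^ b := by
  induction b with
  | zero => simp
  | succ b ih =>
    have e1 := Nat.add_one_mul_choose_eq (2 * b + 8) (b + 1)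
    have e2 := Nat.choose_mul_succ_eq (2 * b + 7) (b + 1)
    rw [show 2 * b + 7 + 1 - (b + 1) = b + 7 by omega] at e2
    have e3 : (2 * b + 9).choose (b + 2) * ((b + 2) * (b + 7)) =
        (2 * b + 9) * (2 * b + 8) * (2 * b + 7).choose (b + 1) := by
      calc _ = ((2 * b + 8 + 1).choose (b + 1 + 1) * (b + 1 + 1)) * (b + 7) := by ring
        _ = (2 * b + 9) * ((2 * b + 7 + 1).choose (b + 1) * (b + 7)) := by rw [← e1]; ring
        _ = _ := by rw [← e2]; ring
    refine Nat.le_of_mul_le_mul_right (c := (b + 2) * (b + 7)) ?_ (by positivity)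
    calc 3 ^ (b + 1) * (2 * (b + 1) + 7).choose (b + 1 + 1) * ((b + 2) * (b + 7))
        = 3 ^ (b + 1) * ((2 * b + 9).choose (b + 2) * ((b + 2) * (b + 7))) := by
          rw [show 2 * (b + 1) + 7 = 2 * b + 9 by ring]; ring
      _ = 3 * ((2 * b + 9) * (2 * b + 8)) * (3 ^ b * (2 * b + 7).choose (b + 1)) := by
          rw [e3]; ring
      _ ≤ 16 * ((b + 2) * (b + 7)) * (7 * 16 ^ b) := Nat.mul_le_mul (by nlinarith) ih
      _ = _ := by ring

theorem choose_mul_rmDim_le {m n : ℕ} (b : ℕ) (h : 49 * n ≤ m + 50) :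
    (((2 * b + 7).choose (b + 1) * rmDim m (n - (b + 1)) : ℕ) : ℝ) ≤
      7 / 48 * (1 / 9) ^ b * rmDim m n := by
  have h1 : (48 : ℝ) ^ (b + 1) * rmDim m (n - (b + 1)) ≤ rmDim m n := by
    exact_mod_cast pow_mul_rmDim_sub_le (b + 1) h
  have h2 : (3 : ℝ) ^ b * (2 * b + 7).choose (b + 1) ≤ 7 * 16 ^ b := by
    exact_mod_cast pow_mul_choose_le b
  push_cast
  have h3 : (0 : ℝ) < 3 ^ b * 48 ^ (b + 1) := by positivity
  refine le_of_mul_le_mul_left ?_ h3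
  calc (3 : ℝ) ^ b * 48 ^ (b + 1) *
        ((2 * b + 7).choose (b + 1) * rmDim m (n - (b + 1)))
      = (3 ^ b * (2 * b + 7).choose (b + 1)) * (48 ^ (b + 1) * rmDim m (n - (b + 1))) := by ring
    _ ≤ (7 * 16 ^ b) * rmDim m n := by gcongr
    _ = _ := by
      have : (48 : ℝ) ^ b = 16 ^ b * 3 ^ b := by rw [← mul_pow]; norm_num
      have h9 : (9 : ℝ) ^ b = 3 ^ b * 3 ^ b := by rw [← mul_pow]; norm_num
      rw [pow_succ, this, one_div, inv_pow, h9]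
      field_simp

/-- The words of relative weight at most `w` in the Reed-Muller code of degree less than `n`. -/
noncomputable abbrev lightWords (m n : ℕ) (w : ℝ) : Finset ((Fin m → ZMod 2) → ZMod 2) :=
  lowWeight (rmSpan m n).toAddSubgroup w

theorem card_lightWords_half_pow_le (m n b : ℕ) :
    (lightWords m n ((1 / 2) ^ (b + 2))).card ≤
      2 * (2 ^ ((2 * b + 7).choose (b + 1) * rmDim m (n - (b + 1))) *
        (lightWords m n ((1 / 2) ^ (b + 3))).card) := by
  -- With `w = d = σ = 2 ^ (-(b + 2))` and `j = b + 1`, the condition `2 ^ j * (w + d) ≤ 1` is an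
  -- equality. The choice `t = 2 * b + 7` makes `4 * σ / (2 ^ t * d ^ 2)` exactly `2 ^ (-(b + 3))`,
  -- half the original weight.
  refine card_lowWeight_le _ (2 * b + 7) (b + 1) _
    (fun v => relIndex_cubeKernel_le n _ _ v) (d := (1 / 2) ^ (b + 2)) (σ := (1 / 2) ^ (b + 2))
    (by positivity) ?_ ?_ ?_
  · simp only [one_div, inv_pow, pow_succ]; field_simp; norm_num
  · intro f hf
    have h1 := (mem_lowWeight.1 hf).2
    have h2 := relWeight_nonneg f
    nlinarith
  · refine le_of_eq ?_
    simp only [one_div, inv_pow, pow_succ, pow_mul']; field_simp; norm_num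

theorem card_lightWords_le_one {m n : ℕ} {w : ℝ} (hw : 2 ^ n * w < 2) :
    (lightWords m n w).card ≤ 1 := by
  refine Finset.card_le_one_iff_subset_singleton.2 ⟨0, fun f hf => ?_⟩
  obtain ⟨h1, h2⟩ := mem_lowWeight.1 hf
  rw [Finset.mem_singleton]
  by_contra h0
  have h3 := two_le_pow_mul_relWeight h1 h0
  have : (0 : ℝ) < 2 ^ n := by positivity
  nlinarith

theorem card_lightWords_le_rpow_aux {m n : ℕ} (h : 49 * n ≤ m + 50) (d b : ℕ)
    (hd : n ≤ b + 2 + d) :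
    ((lightWords m n ((1 / 2) ^ (b + 2))).card : ℝ) ≤
      2 ^ ((d : ℝ) + 21 / 128 * (1 / 9) ^ b * rmDim m n) := by
  induction d generalizing b with
  | zero =>
    -- The weight is now below the minimum distance, so only the zero word is left.
    have h1 : (lightWords m n ((1 / 2) ^ (b + 2))).card ≤ 1 := by
      apply card_lightWords_le_one
      have : (2 : ℝ) ^ n ≤ 2 ^ (b + 2) := pow_le_pow_right₀ (by norm_num) hd
      have h2 : (2 : ℝ) ^ (b + 2) * (1 / 2) ^ (b + 2) = 1 := by rw [← mul_pow]; norm_num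
      have h3 : (0 : ℝ) < (1 / 2) ^ (b + 2) := by positivity
      nlinarith
    calc ((lightWords m n ((1 / 2) ^ (b + 2))).card : ℝ) ≤ 1 := by exact_mod_cast h1
      _ ≤ _ := Real.one_le_rpow (by norm_num) (by positivity)
  | succ d ih =>
    have h1 := card_lightWords_half_pow_le m n b
    have h2 := ih (b + 1) (by omega)
    rw [show b + 1 + 2 = b + 3 by ring] at h2
    set c := (2 * b + 7).choose (b + 1) * rmDim m (n - (b + 1)) with hc
    have h3 : (c : ℝ) ≤ 7 / 48 * (1 / 9) ^ b * rmDim m n := choose_mul_rmDim_le b h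
    calc ((lightWords m n ((1 / 2) ^ (b + 2))).card : ℝ)
        ≤ 2 * (2 ^ c * (lightWords m n ((1 / 2) ^ (b + 3))).card) := by exact_mod_cast h1
      _ ≤ 2 * (2 ^ c * 2 ^ ((d : ℝ) + 21 / 128 * (1 / 9) ^ (b + 1) * rmDim m n)) := by gcongr
      _ = 2 ^ (1 + ((c : ℝ) + ((d : ℝ) + 21 / 128 * (1 / 9) ^ (b + 1) * rmDim m n))) := by
          rw [Real.rpow_add two_pos (1 : ℝ), Real.rpow_one, Real.rpow_add two_pos (c : ℝ),
            Real.rpow_natCast]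
      _ ≤ _ := by
          -- The constant `21/128` is the geometric sum `7/48 / (1 - 1/9)`, so the exponents close
          -- up exactly.
          apply Real.rpow_le_rpow_of_exponent_le (by norm_num)
          rw [pow_succ]
          push_cast
          linarith

/-- The number of words of weight at most `2 ^ (-(b + 2))`. -/
theorem card_lightWords_le_rpow {m n : ℕ} (h : 49 * n ≤ m + 50) (b : ℕ) :
    ((lightWords m n ((1 / 2) ^ (b + 2))).card : ℝ) ≤
      2 ^ ((n : ℝ) + 21 / 128 * (1 / 9) ^ b * rmDim m n) :=
  card_lightWords_le_rpow_aux h n b (by omega)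

/-- The number of words of bias at least `2 ^ (-(i + 2))`. -/
theorem card_biasedWords_le_rpow {m n : ℕ} (i : ℕ) (h : 49 * n + (3 * i + 9) ≤ m + 50)
    (hm : 3 * i + 9 ≤ m) :
    ((lightWords m n ((1 - (1 / 2) ^ (i + 2)) / 2)).card : ℝ) ≤
      2 ^ ((1 : ℝ) + n +
        (1 - (48 / 49) ^ (3 * i + 9) + 21 / 128 * (1 / 9) ^ (i + 1)) * rmDim m n) := by
  have h1 : (lightWords m n ((1 - (1 / 2) ^ (i + 2)) / 2)).card ≤
      2 * (2 ^ (rmDim m n - rmDim (m - (3 * i + 9)) n) *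
        (lightWords m n ((1 / 2) ^ (i + 1 + 2))).card) := by
    -- Here `w + d = 1/2` exactly, as `j = 1` requires; with variance at most `1/4`, the choice `t =
    -- 3 * i + 9` brings the remaining weight down to `2 ^ (-(i + 3))`.
    refine card_lowWeight_le _ (3 * i + 9) 1 _
      (fun v => relIndex_cubeKernel_one_le n _ v) (d := (1 / 2) ^ (i + 3)) (σ := 1 / 4)
      (by positivity) ?_ ?_ ?_
    · simp only [pow_succ]; linarith
    · intro f _
      nlinarith [sq_nonneg (relWeight f - 1 / 2)]
    · refine le_of_eq ?_
      simp only [one_div, inv_pow, pow_succ, pow_mul']; field_simp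
  have h2 := card_lightWords_le_rpow (m := m) (n := n) (by omega) (i + 1)
  have h3 : ((rmDim m n - rmDim (m - (3 * i + 9)) n : ℕ) : ℝ) ≤
      (1 - (48 / 49) ^ (3 * i + 9)) * rmDim m n := by
    rw [Nat.cast_sub (rmDim_mono_left n (Nat.sub_le _ _))]
    have h4 := pow_mul_rmDim_add_le (m := m - (3 * i + 9)) (n := n) (3 * i + 9) (by omega)
    rw [Nat.sub_add_cancel hm] at h4
    have h5 : (48 : ℝ) ^ (3 * i + 9) * rmDim m n ≤
        49 ^ (3 * i + 9) * rmDim (m - (3 * i + 9)) n := by exact_mod_cast h4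
    have h6 : (48 / 49 : ℝ) ^ (3 * i + 9) * rmDim m n ≤ rmDim (m - (3 * i + 9)) n := by
      rw [div_pow, div_mul_eq_mul_div, div_le_iff₀ (by positivity)]
      linarith
    linarith
  set c := rmDim m n - rmDim (m - (3 * i + 9)) n with hc
  calc ((lightWords m n ((1 - (1 / 2) ^ (i + 2)) / 2)).card : ℝ)
      ≤ 2 * (2 ^ c * (lightWords m n ((1 / 2) ^ (i + 1 + 2))).card) := by exact_mod_cast h1
    _ ≤ 2 * (2 ^ c * 2 ^ ((n : ℝ) + 21 / 128 * (1 / 9) ^ (i + 1) * rmDim m n)) := by gcongr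
    _ = 2 ^ (1 + ((c : ℝ) + ((n : ℝ) + 21 / 128 * (1 / 9) ^ (i + 1) * rmDim m n))) := by
        rw [Real.rpow_add two_pos (1 : ℝ), Real.rpow_one, Real.rpow_add two_pos (c : ℝ),
          Real.rpow_natCast]
    _ ≤ _ := by
        apply Real.rpow_le_rpow_of_exponent_le (by norm_num)
        linarith

end WeightDistribution

/-! ### Chernoff and union bounds on the erasure channel. -/

section ErasureChannel

variable {ι : Type*} [Fintype ι]

open Classical in
/-- The number of coordinates that are not erased. -/
noncomputable def keptCount (z : ι → Option (ZMod 2)) : ℕ :=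
  (Finset.univ.filter fun i => z i ≠ none).card

theorem sum_becMass_mul_prod [DecidableEq ι] (p : unitInterval) (y : ι → ZMod 2)
    (h : ι → Option (ZMod 2) → ℝ) :
    ∑ z : ι → Option (ZMod 2), becMass p y z * ∏ i, h i (z i) =
      ∏ i, ((p : ℝ) * h i none + (1 - p) * h i (some (y i))) := by
  have := (Fintype.prod_sum fun (i : ι) (o : Option (ZMod 2)) =>
    (if o = none then (p : ℝ) else if o = some (y i) then 1 - (p : ℝ) else 0) * h i o).symm
  calc _ = ∑ z : ι → Option (ZMod 2), ∏ i, ((if z i = none then (p : ℝ) else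
        if z i = some (y i) then 1 - (p : ℝ) else 0) * h i (z i)) := by
        simp only [becMass, Finset.prod_mul_distrib]
    _ = _ := this
    _ = _ := by
      refine Finset.prod_congr rfl fun i _ => ?_
      rw [Fintype.sum_option]
      simp

theorem pow_keptCount (c : ℝ) (z : ι → Option (ZMod 2)) :
    c ^ keptCount z = ∏ i, (if z i = none then 1 else c) := by
  classical
  rw [keptCount, Finset.prod_ite]
  simp

theorem agreesWith_of_becMass_ne_zero {p : unitInterval} {y : ι → ZMod 2}
    {z : ι → Option (ZMod 2)} (h : becMass p y z ≠ 0) : AgreesWith z y := by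
  intro i
  have := Finset.prod_ne_zero_iff.1 h i (Finset.mem_univ i)
  by_contra hcon
  push Not at hcon
  simp [hcon.1, hcon.2] at this

/-- Lower tail of the number of coordinates that are not erased. -/
theorem sum_becMass_keptCount_lt_le [DecidableEq ι] (p : unitInterval) (y : ι → ZMod 2)
    (s : ℕ) {c : ℝ} (hc0 : 0 < c) (hc1 : c ≤ 1) :
    ∑ z : ι → Option (ZMod 2), (if keptCount z < s then becMass p y z else 0) ≤
      (c ^ s)⁻¹ * Real.exp (-((1 - p) * Fintype.card ι * (1 - c))) := by
  have hcs : 0 < c ^ s := by positivity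
  have hp1 : 0 ≤ 1 - (p : ℝ) := by linarith [p.2.2]
  have h1 : ∀ z : ι → Option (ZMod 2), (if keptCount z < s then becMass p y z else 0) ≤
      (c ^ s)⁻¹ * (becMass p y z * ∏ i, (if z i = none then 1 else c)) := by
    intro z
    have hm := becMass_nonneg p y z
    rw [← pow_keptCount]
    split_ifs with hz
    · have h2 : c ^ s ≤ c ^ keptCount z := pow_le_pow_of_le_one hc0.le hc1 hz.le
      have h3 : 1 ≤ (c ^ s)⁻¹ * c ^ keptCount z := by
        rw [inv_mul_eq_div, one_le_div hcs]; exact h2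
      calc becMass p y z = becMass p y z * 1 := (mul_one _).symm
        _ ≤ becMass p y z * ((c ^ s)⁻¹ * c ^ keptCount z) := by gcongr
        _ = _ := by ring
    · positivity
  refine (Finset.sum_le_sum fun z _ => h1 z).trans ?_
  rw [← Finset.mul_sum, sum_becMass_mul_prod p y fun _ o => if o = none then 1 else c]
  refine mul_le_mul_of_nonneg_left ?_ (by positivity)
  simp only [if_true, reduceCtorEq, if_false, Finset.prod_const, Finset.card_univ]
  have h4 : (p : ℝ) * 1 + (1 - p) * c ≤ Real.exp (-((1 - p) * (1 - c))) := by
    have := Real.add_one_le_exp (-((1 - (p : ℝ)) * (1 - c)))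
    linarith
  calc _ ≤ Real.exp (-((1 - p) * (1 - c))) ^ Fintype.card ι := by
        refine pow_le_pow_left₀ ?_ h4 _
        have := p.2.1
        positivity
    _ = _ := by rw [← Real.exp_nat_mul]; congr 1; ring

open Classical in
/-- The probability that `f` vanishes on the coordinates that are not erased while there are at
least `s` of them. -/
theorem sum_becMass_vanish_le [DecidableEq ι] [Nonempty ι] (p : unitInterval)
    (y f : ι → ZMod 2) {s : ℕ} (hs : s ≠ 0) :
    ∑ z : ι → Option (ZMod 2),
      (if (∀ i, z i ≠ none → f i = 0) ∧ s ≤ keptCount z then becMass p y z else 0) ≤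
      (1 - relWeight f) ^ s := by
  have hw0 := relWeight_nonneg f
  rcases (relWeight_le_one f).eq_or_lt with hw1 | hw1
  · rw [hw1, sub_self, zero_pow hs]
    refine (Finset.sum_eq_zero fun z _ => if_neg ?_).le
    rintro ⟨hz, hk⟩
    have hall : ∀ i, f i ≠ 0 := by
      have hsum := sum_suppInd f
      rw [hw1, mul_one] at hsum
      have h0 : ∑ i, (1 - suppInd f i) = 0 := by
        rw [Finset.sum_sub_distrib, hsum]; simp
      intro i hi
      have := (Finset.sum_eq_zero_iff_of_nonneg
        (fun i _ => sub_nonneg.2 (suppInd_le_one f i))).1 h0 i (Finset.mem_univ i)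
      simp [suppInd, hi] at this
    have : keptCount z = 0 := by
      rw [keptCount, Finset.card_eq_zero, Finset.filter_eq_empty_iff]
      exact fun i _ hi => hall i (hz i hi)
    omega
  · have hpos : 0 < 1 - relWeight f := by linarith
    -- Exponential moment: weight every kept zero of `f` by `c` and every kept nonzero by `0`. For
    -- this `c` the average weight of a coordinate is `1`, so the expectation is at most `1` for
    -- every `p`, while each outcome in the event has weight at least `c ^ s`.
    set c := (1 - relWeight f)⁻¹ with hc
    have hc1 : 1 ≤ c := (one_le_inv₀ hpos).2 (by linarith)
    have hc0 : 0 < c := by linarith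
    have hp0 := p.2.1
    have hp1 : 0 ≤ 1 - (p : ℝ) := by linarith [p.2.2]
    have h1 : ∀ z : ι → Option (ZMod 2),
        (if (∀ i, z i ≠ none → f i = 0) ∧ s ≤ keptCount z then becMass p y z else 0) ≤
        (1 - relWeight f) ^ s * (becMass p y z *
          ∏ i, (if z i = none then 1 else if f i = 0 then c else 0)) := by
      intro z
      have hm := becMass_nonneg p y z
      split_ifs with hz
      · have h2 : ∏ i, (if z i = none then 1 else if f i = 0 then c else 0) =
            c ^ keptCount z := by
          rw [pow_keptCount]
          refine Finset.prod_congr rfl fun i _ => ?_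
          by_cases hi : z i = none
          · simp [hi]
          · simp [hi, hz.1 i hi]
        have h3 : 1 ≤ (1 - relWeight f) ^ s * c ^ keptCount z := by
          calc (1 : ℝ) = (1 - relWeight f) ^ s * c ^ s := by
                rw [← mul_pow, hc, mul_inv_cancel₀ hpos.ne', one_pow]
            _ ≤ _ := by gcongr; exact hz.2
        rw [h2]
        calc becMass p y z = becMass p y z * 1 := (mul_one _).symm
          _ ≤ becMass p y z * ((1 - relWeight f) ^ s * c ^ keptCount z) := by gcongr
          _ = _ := by ring
      · have : 0 ≤ ∏ i, (if z i = none then 1 else if f i = 0 then c else 0) :=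
          Finset.prod_nonneg fun i _ => by split_ifs <;> linarith
        positivity
    refine (Finset.sum_le_sum fun z _ => h1 z).trans ?_
    rw [← Finset.mul_sum, sum_becMass_mul_prod p y
      fun i o => if o = none then 1 else if f i = 0 then c else 0]
    refine mul_le_of_le_one_right (by positivity) ?_
    simp only [if_true, reduceCtorEq, if_false]
    calc _ ≤ ∏ i, Real.exp ((1 - p) * ((1 - suppInd f i) * c - 1)) := by
          refine Finset.prod_le_prod (fun i _ => ?_) fun i _ => ?_
          · split_ifs <;> simp <;> positivity
          · have h := Real.add_one_le_exp ((1 - (p : ℝ)) * ((1 - suppInd f i) * c - 1))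
            refine le_trans (le_of_eq ?_) h
            unfold suppInd
            split_ifs <;> ring
      _ = Real.exp ((1 - p) * (Fintype.card ι * ((1 - relWeight f) * c - 1))) := by
          rw [← Real.exp_sum, ← Finset.mul_sum, Finset.sum_sub_distrib, ← Finset.sum_mul,
            Finset.sum_sub_distrib, sum_suppInd]
          simp only [Finset.sum_const, Finset.card_univ, nsmul_eq_mul]
          congr 1; ring
      _ = 1 := by rw [hc, mul_inv_cancel₀ hpos.ne']; simp

open Classical in
/-- Union bound for the failure of unique recovery on the erasure channel. -/
theorem one_sub_le_becProb_uniquelyRecovers [DecidableEq ι] [Nonempty ι]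
    (C : Submodule (ZMod 2) (ι → ZMod 2)) (p : unitInterval) {y : ι → ZMod 2} (hy : y ∈ C)
    {s : ℕ} (hs : s ≠ 0) {c : ℝ} (hc0 : 0 < c) (hc1 : c ≤ 1) :
    1 - ((c ^ s)⁻¹ * Real.exp (-((1 - p) * Fintype.card ι * (1 - c))) +
      ∑ f ∈ Finset.univ.filter fun f => f ∈ C ∧ f ≠ 0, (1 - relWeight f) ^ s) ≤
      becProb p y (uniquelyRecovers C y) := by
  set F : Finset (ι → ZMod 2) := Finset.univ.filter fun f => f ∈ C ∧ f ≠ 0 with hF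
  have hpt : ∀ z : ι → Option (ZMod 2), becMass p y z ≤
      (if z ∈ uniquelyRecovers C y then becMass p y z else 0) +
      ((if keptCount z < s then becMass p y z else 0) + ∑ f ∈ F,
        (if (∀ i, z i ≠ none → f i = 0) ∧ s ≤ keptCount z then becMass p y z else 0)) := by
    intro z
    have hm := becMass_nonneg p y z
    have hsum : 0 ≤ ∑ f ∈ F,
        (if (∀ i, z i ≠ none → f i = 0) ∧ s ≤ keptCount z then becMass p y z else 0) :=
      Finset.sum_nonneg fun f _ => by split_ifs <;> simp [hm]
    by_cases hE : z ∈ uniquelyRecovers C y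
    · rw [if_pos hE]
      have : 0 ≤ (if keptCount z < s then becMass p y z else 0) := by split_ifs <;> simp [hm]
      linarith
    rw [if_neg hE]
    by_cases hk : keptCount z < s
    · rw [if_pos hk]; linarith
    rw [if_neg hk]
    by_cases h0 : becMass p y z = 0
    · rw [h0] at hsum ⊢; linarith
    have hag := agreesWith_of_becMass_ne_zero h0
    have : ∃ g, (g ∈ C ∧ AgreesWith z g) ∧ g ≠ y := by
      by_contra hcon
      push Not at hcon
      refine hE fun g => ⟨fun hg => hcon g hg, ?_⟩
      rintro rfl
      exact ⟨hy, hag⟩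
    obtain ⟨g, ⟨hgC, hgz⟩, hgy⟩ := this
    -- By linearity the competing codeword matters only through its difference from `y`, so the
    -- bound does not depend on `y`.
    have hmem : g - y ∈ F := by
      simp [hF, sub_mem hgC hy, sub_eq_zero, hgy]
    have hv : (∀ i, z i ≠ none → (g - y) i = 0) ∧ s ≤ keptCount z := by
      refine ⟨fun i hi => ?_, not_lt.1 hk⟩
      have h1 := (hgz i).resolve_left hi
      have h2 := (hag i).resolve_left hi
      rw [h1, Option.some_inj] at h2
      simp [h2]
    have h3 := Finset.single_le_sum (f := fun f : ι → ZMod 2 =>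
      (if (∀ i, z i ≠ none → f i = 0) ∧ s ≤ keptCount z then becMass p y z else 0))
      (fun f _ => by split_ifs <;> simp [hm]) hmem
    simp only [if_pos hv] at h3
    linarith
  have htot := Finset.sum_le_sum fun z (_ : z ∈ Finset.univ) => hpt z
  rw [sum_becMass, Finset.sum_add_distrib, Finset.sum_add_distrib, Finset.sum_comm] at htot
  have h1 := sum_becMass_keptCount_lt_le p y s hc0 hc1
  have h2 := Finset.sum_le_sum fun f (_ : f ∈ F) => sum_becMass_vanish_le p y f hs
  have h3 : becProb p y (uniquelyRecovers C y) = ∑ z : ι → Option (ZMod 2),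
      (if z ∈ uniquelyRecovers C y then becMass p y z else 0) := by
    unfold becProb; congr!
  rw [h3]
  linarith

end ErasureChannel

/-! ### Dyadic decomposition of the union bound. -/

section Shells

/-- Dyadic splitting of the bias `1 - 2 * w`. It starts at bias `1/2`, that is `w = 1/4`; words of
bias below `2 ^ (-(I + 1))` fall into the first term. -/
theorem one_sub_pow_le_add_sum_biased {w : ℝ} (hw : 1 / 4 ≤ w) (hw1 : w ≤ 1) (s I : ℕ) :
    (1 - w) ^ s ≤ ((1 + (1 / 2) ^ (I + 1)) / 2) ^ s + ∑ i ∈ Finset.range I,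
      if w ≤ (1 - (1 / 2) ^ (i + 2)) / 2 then ((1 + (1 / 2) ^ (i + 1)) / 2 : ℝ) ^ s else 0 := by
  induction I with
  | zero =>
    simp only [Finset.range_zero, Finset.sum_empty, add_zero]
    exact pow_le_pow_left₀ (by linarith) (by norm_num; linarith) s
  | succ I ih =>
    rw [Finset.sum_range_succ]
    have hp : (0 : ℝ) ≤ ((1 + (1 / 2) ^ (I + 1 + 1)) / 2) ^ s := by positivity
    by_cases h : w ≤ (1 - (1 / 2) ^ (I + 2)) / 2
    · rw [if_pos h]; linarith
    · rw [if_neg h]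
      have hnn : 0 ≤ ∑ i ∈ Finset.range I,
          if w ≤ (1 - (1 / 2) ^ (i + 2)) / 2 then ((1 + (1 / 2) ^ (i + 1)) / 2 : ℝ) ^ s else 0 :=
        Finset.sum_nonneg fun i _ => by split_ifs <;> positivity
      have : (1 - w) ^ s ≤ ((1 + (1 / 2) ^ (I + 1 + 1)) / 2) ^ s :=
        pow_le_pow_left₀ (by linarith) (by
          rw [show I + 1 + 1 = I + 2 by ring]; linarith [not_le.1 h]) s
      linarith

theorem one_sub_pow_le_add_sum_light {w : ℝ} (hw1 : w ≤ 1) (s : ℕ) {B : ℕ}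
    (hw : (1 / 2) ^ (B + 2) ≤ w) :
    (1 - w) ^ s ≤ (if 1 / 4 ≤ w then (1 - w) ^ s else 0) + ∑ b ∈ Finset.range B,
      if w ≤ (1 / 2) ^ (b + 2) then (1 - (1 / 2) ^ (b + 3) : ℝ) ^ s else 0 := by
  induction B with
  | zero =>
    rw [if_pos (by norm_num at hw ⊢; exact hw)]; simp
  | succ B ih =>
    rw [Finset.sum_range_succ]
    have hle (k : ℕ) : ((1 / 2 : ℝ)) ^ k ≤ 1 := pow_le_one₀ (by norm_num) (by norm_num)
    by_cases h : (1 / 2) ^ (B + 2) ≤ w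
    · have h1 := ih h
      have h2 : 0 ≤ (if w ≤ (1 / 2) ^ (B + 2) then (1 - (1 / 2) ^ (B + 3) : ℝ) ^ s else 0) := by
        have := hle (B + 3)
        split_ifs
        · exact pow_nonneg (by linarith) s
        · exact le_rfl
      linarith
    · rw [if_pos (not_le.1 h).le]
      have h1 : 0 ≤ (if 1 / 4 ≤ w then (1 - w) ^ s else 0) := by
        split_ifs
        · exact pow_nonneg (by linarith) s
        · exact le_rfl
      have h2 : 0 ≤ ∑ b ∈ Finset.range B,
          if w ≤ (1 / 2) ^ (b + 2) then (1 - (1 / 2) ^ (b + 3) : ℝ) ^ s else 0 :=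
        Finset.sum_nonneg fun b _ => by
          have := hle (b + 3)
          split_ifs
          · exact pow_nonneg (by linarith) s
          · exact le_rfl
      have h3 : (1 - w) ^ s ≤ (1 - (1 / 2) ^ (B + 3) : ℝ) ^ s :=
        pow_le_pow_left₀ (by linarith) (by
          rw [show B + 1 + 2 = B + 3 by ring] at hw; linarith) s
      linarith

open Classical in
theorem sum_indicator_relWeight_le {m n : ℕ} (w c : ℝ) (hc : 0 ≤ c) :
    ∑ f ∈ Finset.univ.filter (fun f => f ∈ rmSpan m n ∧ f ≠ 0),
      (if relWeight f ≤ w then c else 0) ≤ (lightWords m n w).card * c := by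
  rw [← Finset.sum_filter, Finset.sum_const, nsmul_eq_mul]
  refine mul_le_mul_of_nonneg_right ?_ hc
  have : ((Finset.univ.filter (fun f => f ∈ rmSpan m n ∧ f ≠ 0)).filter
      fun f => relWeight f ≤ w) ⊆ lightWords m n w := by
    intro f hf
    simp only [Finset.mem_filter, Finset.mem_univ, true_and] at hf
    exact mem_lowWeight.2 ⟨hf.1.1, hf.2⟩
  exact_mod_cast Finset.card_le_card this

open Classical in
/-- Splitting the union bound into shells of words of comparable weight. -/
theorem sum_one_sub_relWeight_pow_le (m n s I : ℕ) :
    ∑ f ∈ Finset.univ.filter (fun f => f ∈ rmSpan m n ∧ f ≠ 0), (1 - relWeight f) ^ s ≤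
      2 ^ rmDim m n * ((1 + (1 / 2) ^ (I + 1)) / 2) ^ s +
      ∑ i ∈ Finset.range I, ((lightWords m n ((1 - (1 / 2) ^ (i + 2)) / 2)).card : ℝ) *
        ((1 + (1 / 2) ^ (i + 1)) / 2) ^ s +
      ∑ b ∈ Finset.range (n - 3), ((lightWords m n ((1 / 2) ^ (b + 2))).card : ℝ) *
        (1 - (1 / 2) ^ (b + 3)) ^ s := by
  set F : Finset ((Fin m → ZMod 2) → ZMod 2) :=
    Finset.univ.filter (fun f => f ∈ rmSpan m n ∧ f ≠ 0) with hF
  have hpt : ∀ f ∈ F, (1 - relWeight f) ^ s ≤ ((1 + (1 / 2) ^ (I + 1)) / 2) ^ s +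
      (∑ i ∈ Finset.range I, if relWeight f ≤ (1 - (1 / 2) ^ (i + 2)) / 2 then
        ((1 + (1 / 2) ^ (i + 1)) / 2 : ℝ) ^ s else 0) +
      ∑ b ∈ Finset.range (n - 3),
        if relWeight f ≤ (1 / 2) ^ (b + 2) then (1 - (1 / 2) ^ (b + 3) : ℝ) ^ s else 0 := by
    intro f hf
    obtain ⟨-, hfC, hf0⟩ := Finset.mem_filter.1 hf
    have hmin := two_le_pow_mul_relWeight hfC hf0
    have hw : (1 / 2) ^ (n - 3 + 2) ≤ relWeight f := by
      have h1 : ((1 / 2 : ℝ)) ^ (n - 3 + 2) * (1 / 2) ≤ (1 / 2) ^ n := by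
        rw [← pow_succ]
        exact pow_le_pow_of_le_one (by norm_num) (by norm_num) (by omega)
      have h2 : (1 / 2 : ℝ) ^ n * (2 ^ n) = 1 := by rw [← mul_pow]; norm_num
      have h3 : (0 : ℝ) < (1 / 2) ^ n := by positivity
      have h4 := mul_le_mul_of_nonneg_left hmin h3.le
      rw [← mul_assoc, h2, one_mul] at h4
      linarith
    have h1 := one_sub_pow_le_add_sum_light (relWeight_le_one f) s hw
    refine h1.trans (add_le_add_left ?_ _)
    split_ifs with h
    · exact one_sub_pow_le_add_sum_biased h (relWeight_le_one f) s I
    · refine add_nonneg (by positivity) (Finset.sum_nonneg fun i _ => ?_)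
      split_ifs <;> positivity
  refine (Finset.sum_le_sum hpt).trans ?_
  rw [Finset.sum_add_distrib, Finset.sum_add_distrib, Finset.sum_comm,
    Finset.sum_comm (s := F) (t := Finset.range (n - 3))]
  refine add_le_add (add_le_add ?_ ?_) ?_
  · rw [Finset.sum_const, nsmul_eq_mul]
    refine mul_le_mul_of_nonneg_right ?_ (by positivity)
    have h1 : F.card ≤ Nat.card (rmSpan m n) := by
      rw [Nat.card_eq_fintype_card, Fintype.card_subtype]
      exact Finset.card_le_card fun f hf => by
        simp only [hF, Finset.mem_filter, Finset.mem_univ, true_and] at hf ⊢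
        exact hf.1
    rw [natCard_rmSpan] at h1
    exact_mod_cast h1
  · exact Finset.sum_le_sum fun i _ => sum_indicator_relWeight_le _ _ (by positivity)
  · refine Finset.sum_le_sum fun b _ => sum_indicator_relWeight_le _ _ (pow_nonneg ?_ s)
    have : ((1 / 2 : ℝ)) ^ (b + 3) ≤ 1 := pow_le_one₀ (by norm_num) (by norm_num)
    linarith

end Shells

/-! ### Every contribution tends to zero. -/

section Asymptotics

theorem rmDim_le_two_pow (m n : ℕ) : rmDim m n ≤ 2 ^ m := by
  rw [← finrank_rmSpan]
  refine (Submodule.finrank_le _).trans ?_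
  simp

/-- The gain on a light shell may be as small as a multiple of `2 ^ (-n)` times the dimension; this
bound keeps it quadratic in `m`. -/
theorem mul_le_rmDim {m n : ℕ} (h3 : 3 ≤ n) (h : 49 * n ≤ m + 50) :
    2 ^ n * (m * (m - 1)) ≤ 16 * rmDim m n := by
  have h1 := pow_mul_rmDim_sub_le (m := m) (n := n) (n - 3) h
  rw [Nat.sub_sub_self h3] at h1
  have h2 : m * (m - 1) ≤ 2 * rmDim m 3 := by
    have : m.choose 2 ≤ rmDim m 3 := by
      simp [rmDim, Finset.sum_range_succ]
    have h4 := Nat.choose_two_right m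
    have h5 : m * (m - 1) = 2 * m.choose 2 := by
      rw [h4, Nat.mul_div_cancel' (Nat.even_mul_pred_self m).two_dvd]
    omega
  calc 2 ^ n * (m * (m - 1)) ≤ 2 ^ n * (2 * rmDim m 3) := Nat.mul_le_mul_left _ h2
    _ = 16 * (2 ^ (n - 3) * rmDim m 3) := by
      conv_lhs => rw [← Nat.sub_add_cancel h3, pow_add]
      ring
    _ ≤ 16 * (48 ^ (n - 3) * rmDim m 3) := by gcongr; norm_num
    _ ≤ 16 * rmDim m n := Nat.mul_le_mul_left _ h1

theorem mul_le_two_mul_rmDim {m n : ℕ} (h2 : 2 ≤ n) (h : 49 * n ≤ m + 50) :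
    m * n ≤ 2 * rmDim m n := by
  rcases h2.eq_or_lt with rfl | h3
  · simp [rmDim, Finset.sum_range_succ]; omega
  · have h1 := mul_le_rmDim h3 h
    have h4 : 2 ^ 3 ≤ 2 ^ n := Nat.pow_le_pow_right (by norm_num) h3
    have h5 : m * n ≤ m * (m - 1) := Nat.mul_le_mul_left _ (by omega)
    have h6 : 2 ^ 3 * (m * (m - 1)) ≤ 2 ^ n * (m * (m - 1)) := Nat.mul_le_mul_right _ h4
    omega

theorem pow_le_two_rpow {x c : ℝ} (hx : 0 ≤ 1 - x) (hc : c * Real.log 2 ≤ x) {k : ℝ} {s : ℕ}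
    (hk0 : 0 ≤ k) (hc0 : 0 ≤ c) (hk : k ≤ s) : (1 - x) ^ s ≤ (2 : ℝ) ^ (-(c * k)) := by
  have h1 : 1 - x ≤ Real.exp (-x) := by linarith [Real.add_one_le_exp (-x)]
  have hl : 0 < Real.log 2 := Real.log_pos (by norm_num)
  calc (1 - x) ^ s ≤ Real.exp (-x) ^ s := pow_le_pow_left₀ hx h1 s
    _ = Real.exp (s * -x) := by rw [← Real.exp_nat_mul]
    _ ≤ Real.exp (Real.log 2 * -(c * k)) := by
      apply Real.exp_le_exp.2
      have : Real.log 2 * (c * k) ≤ s * x := by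
        calc Real.log 2 * (c * k) = k * (c * Real.log 2) := by ring
          _ ≤ k * x := by gcongr
          _ ≤ s * x := by
            gcongr
            exact le_trans (by positivity) hc
      linarith
    _ = _ := by rw [Real.rpow_def_of_pos two_pos]

theorem half_add_pow_le_two_rpow {x c : ℝ} (hx : 0 ≤ x) (hc : x ≤ c * Real.log 2) {k : ℝ} {s : ℕ}
    (hc0 : c ≤ 1) (hk : k ≤ s) :
    ((1 + x) / 2) ^ s ≤ (2 : ℝ) ^ (-((1 - c) * k)) := by
  have hl : 0 < Real.log 2 := Real.log_pos (by norm_num)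
  have h1 : (1 + x) / 2 ≤ Real.exp (Real.log 2 * -(1 - c)) := by
    have : Real.exp (Real.log 2 * -(1 - c)) = Real.exp (c * Real.log 2) / 2 := by
      rw [show Real.log 2 * -(1 - c) = c * Real.log 2 - Real.log 2 by ring, Real.exp_sub,
        Real.exp_log two_pos]
    rw [this]
    have := Real.add_one_le_exp x
    have := Real.exp_le_exp.2 hc
    linarith
  calc ((1 + x) / 2) ^ s ≤ Real.exp (Real.log 2 * -(1 - c)) ^ s :=
        pow_le_pow_left₀ (by positivity) h1 s
    _ = Real.exp (Real.log 2 * -((1 - c) * s)) := by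
      rw [← Real.exp_nat_mul]; congr 1; ring
    _ ≤ Real.exp (Real.log 2 * -((1 - c) * k)) := by
      apply Real.exp_le_exp.2
      have : (1 - c) * k ≤ (1 - c) * s := mul_le_mul_of_nonneg_left hk (by linarith)
      nlinarith
    _ = _ := by rw [Real.rpow_def_of_pos two_pos]

/-- The exponent gained on the shell of words of bias about `2 ^ (-(i + 2))`. -/
theorem biased_exponent_pos (i : ℕ) :
    0 < (48 / 49 : ℝ) ^ (3 * i + 9) - 21 / 128 * (1 / 9) ^ (i + 1) -
      (1 / 2) ^ (i + 1) / Real.log 2 := by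
  have hl := Real.log_two_gt_d9
  -- The case `i = 0` is the tight one: `(48/49) ^ 9 > 0.83`, against `1 / (2 * log 2) < 0.73` and
  -- `7/384 < 0.02`. For larger `i`, `(48/49) ^ 3` decays more slowly than `1/2`.
  have h1 : (83 / 100 : ℝ) * (1 / 2) ^ i ≤ (48 / 49) ^ (3 * i + 9) := by
    rw [pow_add, pow_mul, mul_comm]
    gcongr <;> norm_num
  have h2 : (1 / 9 : ℝ) ^ i ≤ (1 / 2) ^ i := by gcongr; norm_num
  have h3 : (1 / 2 : ℝ) ^ (i + 1) / Real.log 2 ≤ (1 / 2) ^ i * (73 / 100) := by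
    rw [div_le_iff₀ (by linarith), pow_succ, mul_assoc]
    gcongr
    linarith
  have h4 : (0 : ℝ) < (1 / 2) ^ i := by positivity
  rw [pow_succ (1 / 9 : ℝ)]
  linarith

variable {n : ℕ → ℕ}

theorem tendsto_rmDim (hn2 : ∀ᶠ m in atTop, 2 ≤ n m)
    (hn : ∀ T, ∀ᶠ m in atTop, 49 * n m + T ≤ m + 50) :
    Tendsto (fun m => (rmDim m (n m) : ℝ)) atTop atTop := by
  refine tendsto_atTop_mono' _ ?_ tendsto_natCast_atTop_atTop
  filter_upwards [hn2, hn 0] with m h1 h2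
  have h3 := mul_le_two_mul_rmDim h1 h2
  have : m * 2 ≤ m * n m := Nat.mul_le_mul_left _ h1
  exact_mod_cast (by omega : m ≤ rmDim m (n m))

theorem tendsto_two_rpow_neg_mul_rmDim (hn2 : ∀ᶠ m in atTop, 2 ≤ n m)
    (hn : ∀ T, ∀ᶠ m in atTop, 49 * n m + T ≤ m + 50) {κ : ℝ} (hκ : 0 < κ) (a : ℝ) :
    Tendsto (fun m => (2 : ℝ) ^ (a + n m - κ * rmDim m (n m))) atTop (𝓝 0) := by
  have hK := tendsto_rmDim hn2 hn
  have h1 : Tendsto (fun m => a - κ / 2 * (rmDim m (n m) : ℝ)) atTop atBot :=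
    tendsto_atBot_add_const_left _ a
      (tendsto_neg_atTop_atBot.comp (hK.const_mul_atTop (half_pos hκ)))
  have h2 := (tendsto_rpow_atBot_of_base_gt_one 2 (by norm_num)).comp h1
  refine squeeze_zero' (Eventually.of_forall fun m => by positivity) ?_ h2
  obtain ⟨M, hM⟩ := exists_nat_gt (4 / κ)
  filter_upwards [hn2, hn 0, eventually_ge_atTop (max M 1)] with m hm2 hm0 hmM
  apply Real.rpow_le_rpow_of_exponent_le (by norm_num)
  have h3 : ((m * n m : ℕ) : ℝ) ≤ ((2 * rmDim m (n m) : ℕ) : ℝ) := by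
    exact_mod_cast mul_le_two_mul_rmDim hm2 hm0
  push_cast at h3
  have h4 : 4 / κ ≤ m := hM.le.trans (by exact_mod_cast (le_max_left M 1).trans hmM)
  rw [div_le_iff₀ hκ] at h4
  have h5 : (0 : ℝ) < m := by exact_mod_cast (le_max_right M 1).trans hmM
  have h6 : (n m : ℝ) ≤ κ / 2 * rmDim m (n m) := by
    refine le_of_mul_le_mul_left ?_ h5
    have : (0 : ℝ) ≤ rmDim m (n m) := Nat.cast_nonneg _
    nlinarith
  linarith

theorem tendsto_biased_shell (hn2 : ∀ᶠ m in atTop, 2 ≤ n m)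
    (hn : ∀ T, ∀ᶠ m in atTop, 49 * n m + T ≤ m + 50) {s : ℕ → ℕ}
    (hs : ∀ m, rmDim m (n m) ≤ s m) (i : ℕ) :
    Tendsto (fun m => ((lightWords m (n m) ((1 - (1 / 2) ^ (i + 2)) / 2)).card : ℝ) *
      ((1 + (1 / 2) ^ (i + 1)) / 2) ^ s m) atTop (𝓝 0) := by
  refine squeeze_zero' (Eventually.of_forall fun m => by positivity) ?_
    (tendsto_two_rpow_neg_mul_rmDim hn2 hn (biased_exponent_pos i) 1)
  have hl : 0 < Real.log 2 := Real.log_pos (by norm_num)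
  filter_upwards [hn (3 * i + 9), eventually_ge_atTop (3 * i + 9)] with m hm hmi
  have h1 := card_biasedWords_le_rpow i hm hmi
  have hc1 : (1 / 2 : ℝ) ^ (i + 1) / Real.log 2 ≤ 1 := by
    have := biased_exponent_pos i
    have h2 : (48 / 49 : ℝ) ^ (3 * i + 9) ≤ 1 := pow_le_one₀ (by norm_num) (by norm_num)
    have h3 : (0 : ℝ) ≤ (1 / 9) ^ (i + 1) := by positivity
    linarith
  have h2 := half_add_pow_le_two_rpow (x := (1 / 2) ^ (i + 1))
    (c := (1 / 2) ^ (i + 1) / Real.log 2) (k := rmDim m (n m)) (s := s m) (by positivity)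
    (by rw [div_mul_cancel₀ _ hl.ne']) hc1 (by exact_mod_cast hs m)
  refine (mul_le_mul h1 h2 (by positivity) (by positivity)).trans ?_
  rw [← Real.rpow_add two_pos]
  apply Real.rpow_le_rpow_of_exponent_le (by norm_num)
  linarith

theorem tendsto_light_shells
    (hn : ∀ T, ∀ᶠ m in atTop, 49 * n m + T ≤ m + 50) {s : ℕ → ℕ}
    (hs : ∀ m, rmDim m (n m) ≤ s m) :
    Tendsto (fun m => ∑ b ∈ Finset.range (n m - 3),
      ((lightWords m (n m) ((1 / 2) ^ (b + 2))).card : ℝ) * (1 - (1 / 2) ^ (b + 3)) ^ s m)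
      atTop (𝓝 0) := by
  have hle (k : ℕ) : ((1 / 2 : ℝ)) ^ k ≤ 1 := pow_le_one₀ (by norm_num) (by norm_num)
  refine squeeze_zero' (Eventually.of_forall fun m => Finset.sum_nonneg fun b _ =>
    mul_nonneg (Nat.cast_nonneg _) (pow_nonneg (by linarith [hle (b + 3)]) _)) ?_
    (tendsto_pow_atTop_nhds_zero_of_lt_one (r := (1 / 2 : ℝ)) (by norm_num) (by norm_num))
  filter_upwards [hn 0, eventually_ge_atTop 193] with m hm hm193
  have hl := Real.log_two_lt_d9
  have hterm : ∀ b ∈ Finset.range (n m - 3),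
      ((lightWords m (n m) ((1 / 2) ^ (b + 2))).card : ℝ) * (1 - (1 / 2) ^ (b + 3)) ^ s m ≤
      (1 / 2) ^ m * (2 ^ m)⁻¹ := by
    intro b hb
    have hb' := Finset.mem_range.1 hb
    have h1 := card_lightWords_le_rpow (m := m) (n := n m) hm b
    -- The constant `0.18` fits between `21/128 ≈ 0.164`, the exponent of the count, and `1 / (8 *
    -- log 2) ≈ 0.1803`, the available decay.
    have h2 := pow_le_two_rpow (x := (1 / 2) ^ (b + 3)) (c := 18 / 100 * (1 / 2) ^ b)
      (k := rmDim m (n m)) (s := s m) (by linarith [hle (b + 3)]) (by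
        rw [pow_add, mul_comm (18 / 100 : ℝ), mul_assoc]
        gcongr
        norm_num; linarith) (by positivity) (by positivity) (by exact_mod_cast hs m)
    refine (mul_le_mul h1 h2 (pow_nonneg (by linarith [hle (b + 3)]) _) (by positivity)).trans ?_
    rw [← Real.rpow_add two_pos]
    have h3 : (1 / 2 : ℝ) ^ m * (2 ^ m)⁻¹ = 2 ^ (-(2 * m) : ℝ) := by
      rw [one_div, inv_pow, ← mul_inv, ← pow_add, Real.rpow_neg two_pos.le, ← two_mul,
        ← Real.rpow_natCast]
      push_cast; rfl
    rw [h3]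
    apply Real.rpow_le_rpow_of_exponent_le (by norm_num)
    have h4 : ((2 ^ n m * (m * (m - 1)) : ℕ) : ℝ) ≤ ((16 * rmDim m (n m) : ℕ) : ℝ) := by
      exact_mod_cast mul_le_rmDim (by omega) hm
    rw [Nat.cast_mul, Nat.cast_mul, Nat.cast_sub (by omega)] at h4
    push_cast at h4
    have h5 : (1 / 9 : ℝ) ^ b ≤ (1 / 2) ^ b := by gcongr; norm_num
    have h6 : (1 / 2 : ℝ) ^ n m * 16 ≤ (1 / 2) ^ b := by
      have : (1 / 2 : ℝ) ^ n m ≤ (1 / 2) ^ (b + 4) :=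
        pow_le_pow_of_le_one (by norm_num) (by norm_num) (by omega)
      rw [pow_add] at this
      linarith
    have h7 : (m : ℝ) * (m - 1) ≤ (1 / 2) ^ n m * 16 * rmDim m (n m) := by
      have h8 : (1 / 2 : ℝ) ^ n m * 2 ^ n m = 1 := by rw [← mul_pow]; norm_num
      calc (m : ℝ) * (m - 1) = (1 / 2) ^ n m * (2 ^ n m * (m * (m - 1))) := by
            rw [← mul_assoc, h8, one_mul]
        _ ≤ (1 / 2) ^ n m * (16 * rmDim m (n m)) := by gcongr
        _ = _ := by ring
    have hK : (0 : ℝ) ≤ rmDim m (n m) := Nat.cast_nonneg _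
    have h9 : (m : ℝ) * (m - 1) ≤ (1 / 2) ^ b * rmDim m (n m) :=
      h7.trans (mul_le_mul_of_nonneg_right h6 hK)
    have h10 : (1 / 9 : ℝ) ^ b * rmDim m (n m) ≤ (1 / 2) ^ b * rmDim m (n m) :=
      mul_le_mul_of_nonneg_right h5 hK
    have h11 : (n m : ℝ) ≤ m := by exact_mod_cast (by omega : n m ≤ m)
    have h12 : (193 : ℝ) ≤ m := by exact_mod_cast hm193
    -- The gap `0.18 - 21/128` times `m * (m - 1)` must exceed `3 * m`, which accounts for `n m ≤ m`
    -- and the target `2 * m`; `m ≥ 193` suffices.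
    nlinarith
  refine (Finset.sum_le_sum hterm).trans ?_
  rw [Finset.sum_const, Finset.card_range, nsmul_eq_mul]
  have h1 : ((n m - 3 : ℕ) : ℝ) ≤ 2 ^ m := by
    exact_mod_cast (by omega : n m - 3 ≤ m).trans Nat.lt_two_pow_self.le
  calc ((n m - 3 : ℕ) : ℝ) * ((1 / 2) ^ m * (2 ^ m)⁻¹)
      ≤ 2 ^ m * ((1 / 2) ^ m * (2 ^ m)⁻¹) := by gcongr
    _ = (1 / 2) ^ m := by field_simp

/-- All codewords are counted here. For small bias each costs nearly `2 ^ (-s)`, so `s ≥ (1 + δ) K`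
wins once `I` is large in terms of `δ`; half of `δ` absorbs the bias. -/
theorem exists_tendsto_balanced_shell (hn2 : ∀ᶠ m in atTop, 2 ≤ n m)
    (hn : ∀ T, ∀ᶠ m in atTop, 49 * n m + T ≤ m + 50) {δ : ℝ} (hδ : 0 < δ) {s : ℕ → ℕ}
    (hs : ∀ m, (1 + δ) * rmDim m (n m) ≤ s m) :
    ∃ I : ℕ, Tendsto (fun m => (2 : ℝ) ^ rmDim m (n m) *
      ((1 + (1 / 2) ^ (I + 1)) / 2) ^ s m) atTop (𝓝 0) := by
  have hl : 0 < Real.log 2 := Real.log_pos (by norm_num)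
  set c := δ / (2 * (1 + δ)) with hc
  have hc0 : 0 < c := by positivity
  have hc1 : c ≤ 1 := by rw [hc, div_le_one (by positivity)]; linarith
  obtain ⟨I, hI⟩ := exists_pow_lt_of_lt_one (mul_pos hc0 hl) (show (1 / 2 : ℝ) < 1 by norm_num)
  refine ⟨I, ?_⟩
  refine squeeze_zero' (Eventually.of_forall fun m => by positivity) ?_
    (tendsto_two_rpow_neg_mul_rmDim hn2 hn (half_pos hδ) 0)
  refine Eventually.of_forall fun m => ?_
  have h1 := half_add_pow_le_two_rpow (x := (1 / 2) ^ (I + 1)) (c := c)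
    (k := (1 + δ) * rmDim m (n m)) (s := s m) (by positivity)
    (le_trans (pow_le_pow_of_le_one (by norm_num) (by norm_num) (Nat.le_succ I)) hI.le)
    hc1 (hs m)
  refine (mul_le_mul_of_nonneg_left h1 (by positivity)).trans ?_
  rw [← Real.rpow_natCast, ← Real.rpow_add two_pos]
  apply Real.rpow_le_rpow_of_exponent_le (by norm_num)
  have h2 : (1 - c) * ((1 + δ) * rmDim m (n m)) = (1 + δ / 2) * rmDim m (n m) := by
    rw [hc]; field_simp; ring
  rw [h2]
  have : (0 : ℝ) ≤ n m := Nat.cast_nonneg _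
  linarith

theorem tendsto_keptCount_tail (hn2 : ∀ᶠ m in atTop, 2 ≤ n m)
    (hn : ∀ T, ∀ᶠ m in atTop, 49 * n m + T ≤ m + 50) {α β : ℝ} (hα : 0 < α) (hαβ : α < β) :
    Tendsto (fun m => ((α / β) ^ ⌈α * rmDim m (n m)⌉₊)⁻¹ *
      Real.exp (-(β * rmDim m (n m) * (1 - α / β)))) atTop (𝓝 0) := by
  have hβ : 0 < β := hα.trans hαβ
  set c := α / β with hc
  have hc0 : 0 < c := by positivity
  have hc1 : c < 1 := by rw [hc, div_lt_one hβ]; exact hαβ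
  -- The Chernoff exponent per unit of dimension at the optimal parameter `α / β`; it is positive by
  -- strict concavity of the logarithm.
  have hκ : 0 < β - α + α * Real.log c := by
    have h1 := Real.log_lt_sub_one_of_pos (inv_pos.2 hc0) (by
      intro h; rw [inv_eq_one] at h; linarith)
    rw [Real.log_inv] at h1
    have h2 : α * c⁻¹ = β := by rw [hc]; field_simp
    nlinarith
  have hlog : Real.log c < 0 := Real.log_neg hc0 hc1
  have hK := tendsto_rmDim hn2 hn
  have h1 : Tendsto (fun m => -Real.log c - (β - α + α * Real.log c) * (rmDim m (n m) : ℝ))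
      atTop atBot :=
    tendsto_atBot_add_const_left _ _ (tendsto_neg_atTop_atBot.comp (hK.const_mul_atTop hκ))
  refine squeeze_zero (fun m => by positivity) (fun m => ?_) (Real.tendsto_exp_atBot.comp h1)
  have h2 : (c ^ ⌈α * rmDim m (n m)⌉₊)⁻¹ =
      Real.exp (-(⌈α * rmDim m (n m)⌉₊ * Real.log c)) := by
    rw [Real.exp_neg, Real.exp_nat_mul, Real.exp_log hc0]
  rw [h2, ← Real.exp_add]
  refine Real.exp_le_exp.2 ?_
  have h3 : (⌈α * rmDim m (n m)⌉₊ : ℝ) ≤ α * rmDim m (n m) + 1 :=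
    (Nat.ceil_lt_add_one (by positivity)).le
  have h4 : β * rmDim m (n m) * (1 - c) = (β - α) * rmDim m (n m) := by
    rw [hc]; field_simp
  rw [h4]
  nlinarith

/-- The rate tends to `0`: raising the degree by `J` still respects the degree hypothesis and
multiplies the dimension by at least `48 ^ J`, yet the dimension never exceeds the length. -/
theorem eventually_mul_rmDim_le (hn : ∀ T, ∀ᶠ m in atTop, 49 * n m + T ≤ m + 50) (c : ℝ) :
    ∀ᶠ m in atTop, c * (rmDim m (n m) : ℝ) ≤ 2 ^ m := by
  obtain ⟨J, hJ⟩ := pow_unbounded_of_one_lt c (show (1 : ℝ) < 48 by norm_num)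
  filter_upwards [hn (49 * J)] with m hm
  have h1 := pow_mul_rmDim_sub_le (m := m) (n := n m + J) J (by omega)
  rw [Nat.add_sub_cancel] at h1
  have h2 : (48 : ℝ) ^ J * rmDim m (n m) ≤ 2 ^ m := by
    exact_mod_cast h1.trans (rmDim_le_two_pow _ _)
  exact (mul_le_mul_of_nonneg_right hJ.le (Nat.cast_nonneg _)).trans h2

theorem achievesCapacityBEC_reedMuller {r : ℕ → ℕ} (hr1 : ∀ᶠ m in atTop, 1 ≤ r m)
    (hr : ∀ T, ∀ᶠ m in atTop, 49 * r m + T ≤ m) :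
    AchievesCapacityBEC (fun m => reedMuller m (r m)) := by
  intro δ hδ ε hε
  set n : ℕ → ℕ := fun m => r m + 1 with hn_def
  have hn2 : ∀ᶠ m in atTop, 2 ≤ n m := by
    filter_upwards [hr1] with m hm; simp only [hn_def]; omega
  have hn : ∀ T, ∀ᶠ m in atTop, 49 * n m + T ≤ m + 50 := by
    intro T
    filter_upwards [hr T] with m hm; simp only [hn_def]; omega
  -- The threshold lies halfway between the dimension and the expected number of kept coordinates,
  -- leaving room for the balanced shell on one side and the Chernoff bound on the other.
  set s : ℕ → ℕ := fun m => ⌈(1 + δ / 2) * rmDim m (n m)⌉₊ with hs_def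
  have hs : ∀ m, (1 + δ / 2) * rmDim m (n m) ≤ s m := fun m => Nat.le_ceil _
  have hs' : ∀ m, rmDim m (n m) ≤ s m := fun m => by
    have h1 := hs m
    have h2 : (0 : ℝ) ≤ δ / 2 * rmDim m (n m) := by positivity
    exact_mod_cast (by linarith : (rmDim m (n m) : ℝ) ≤ s m)
  obtain ⟨I, hI⟩ := exists_tendsto_balanced_shell hn2 hn (half_pos hδ) hs
  have hT := tendsto_keptCount_tail hn2 hn (α := 1 + δ / 2) (β := 1 + δ) (by linarith)
    (by linarith)
  have hB := tendsto_finsetSum (Finset.range I) fun i _ => tendsto_biased_shell hn2 hn hs' i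
  have hL := tendsto_light_shells hn hs'
  have hall := hT.add ((hI.add hB).add hL)
  simp only [Finset.sum_const_zero, add_zero] at hall
  filter_upwards [hall.eventually_le_const hε, eventually_mul_rmDim_le hn (1 + δ),
    (tendsto_rmDim hn2 hn).eventually_ge_atTop 1] with m hm hp hK y hy
  rw [reedMuller_eq_rmSpan] at hy ⊢
  have hcard : (Fintype.card (Fin m → ZMod 2) : ℝ) = 2 ^ m := by simp
  have hpv : 1 - (erasureParam (codeRate (rmSpan m (n m))) δ : ℝ) =
      rmDim m (n m) / 2 ^ m * (1 + δ) := by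
    have hR : codeRate (rmSpan m (n m)) = rmDim m (n m) / 2 ^ m := by
      rw [codeRate, finrank_rmSpan, hcard]
    have h1 : rmDim m (n m) / 2 ^ m * (1 + δ) ≤ (1 : ℝ) := by
      rw [div_mul_eq_mul_div, div_le_one (by positivity)]; linarith
    have h2 : (0 : ℝ) ≤ rmDim m (n m) / 2 ^ m * (1 + δ) := by positivity
    rw [hR, erasureParam, Set.projIcc_of_mem _ ⟨by linarith, by linarith⟩]
    simp
  have hs0 : s m ≠ 0 := by
    have := hs' m
    have h1 : 1 ≤ rmDim m (n m) := by exact_mod_cast hK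
    omega
  have hmain := one_sub_le_becProb_uniquelyRecovers (rmSpan m (n m))
    (erasureParam (codeRate (rmSpan m (n m))) δ) hy hs0
    (c := (1 + δ / 2) / (1 + δ)) (by positivity)
    (by rw [div_le_one (by linarith)]; linarith)
  have hsum := sum_one_sub_relWeight_pow_le m (n m) (s m) I
  refine le_trans ?_ hmain
  have hexp : (1 - (erasureParam (codeRate (rmSpan m (n m))) δ : ℝ)) *
      Fintype.card (Fin m → ZMod 2) = (1 + δ) * rmDim m (n m) := by
    rw [hpv, hcard]; field_simp
  rw [hexp]
  have hsm : ⌈(1 + δ / 2) * (rmDim m (n m) : ℝ)⌉₊ = s m := rfl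
  rw [hsm] at hm
  linarith

end Asymptotics

theorem theorem1p7 (γ : ℕ → ℝ) (hγ : ∀ m, 0 < γ m ∧ γ m ≤ 1 / 50) :
    AchievesCapacityBEC (fun m : ℕ => reedMuller m ⌈γ m * (m : ℝ)⌉₊) := by
  refine achievesCapacityBEC_reedMuller ?_ fun T => ?_
  · filter_upwards [eventually_ge_atTop 1] with m hm
    have : (0 : ℝ) < m := by exact_mod_cast hm
    exact Nat.ceil_pos.2 (mul_pos (hγ m).1 this)
  -- The margin between `1/50` and `1/49` absorbs both the rounding up of the degree and the
  -- arbitrary constant `T`.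
  · filter_upwards [eventually_ge_atTop (50 * (49 + T))] with m hm
    have h1 : (⌈γ m * (m : ℝ)⌉₊ : ℝ) < γ m * m + 1 :=
      Nat.ceil_lt_add_one (mul_nonneg (hγ m).1.le (Nat.cast_nonneg _))
    have h2 : γ m * m ≤ 1 / 50 * m := mul_le_mul_of_nonneg_right (hγ m).2 (Nat.cast_nonneg _)
    have h3 : (50 * (49 + T) : ℝ) ≤ m := by exact_mod_cast hm
    have h4 : (49 * ⌈γ m * (m : ℝ)⌉₊ + T : ℝ) ≤ m := by linarith
    exact_mod_cast h4
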